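/- Let $N\in\{2,3,4\}$ and let $V$ be an $N$-dimensional real vector space (the tangent space at a point of a Lorentzian manifold) with a Lorentzian metric $g$ of signature $(+,-,\dots,-)$ and a time orientation. For a $p$-form $\Omega$ on $V$ with $1\le p\le N-1$, the superenergy tensor is $$T_{ab}\{\Omega\}=\tfrac12\big[(\Omega\odot\Omega)_{ab}+({*\Omega}\odot{*\Omega})_{ab}\big],\qquad (A\odot A)_{ab}=\frac{(-1)^{n-1}}{(n-1)!}A_{ac_2\dots c_n}A_b{}^{c_2\dots c_n}\ \text{ for an } n\text{-form } A,$$ where $*$ is the Hodge dual; for an $N$-form $\Omega=f\eta$, with $\eta$ the volume form, $T_{ab}\{\Omega\}=\tfrac12f^2g_{ab}$. Let $\mathcal{SE}_2$ be the set of the superenergy tensors of all $p$-forms, $1\le p\le N$, and $\mathcal{SS}$ the set of the superenergy tensors of simple $p$-forms, $1\le p\le N$, a $p$-form being simple if it is a wedge product of $p$ linearly independent 1-forms. Write $-\mathcal{SE}_2=\{T: -T\in\mathcal{SE}_2\}$. A linear map of $V$ is null-cone preserving if it maps null vectors to null vectors (the zero vector counting as null); it is then orthochronous (time-reversing) if it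 maps every future-pointing null vector to zero or to a future-pointing (past-pointing) null vector. A rank-2 tensor $T_{ab}$ is identified with the map $k^a\mapsto k^aT_a{}^b$, and it is bi-preserving if both this map and $k_b\mapsto T_a{}^bk_b$ preserve the null cone. Then: (1) $\mathcal{SE}_2\setminus\{0\}=\mathcal{SS}$. (2) $\mathcal{SE}_2$ is exactly the set of symmetric tensors $T_{ab}$ that leave the null cone invariant and preserve its time orientation (orthochronous null-cone preserving maps). (3) $\mathcal{SE}_2$ is the union of the set of all positive multiples of involutory orthochronous Lorentz transformations and the set of all symmetric singular orthochronous null-cone bi-preserving maps. (4) $-\mathcal{SE}_2$ is exactly the set of symmetric tensors that leave the null cone invariant and reverse its time orientation; it is the union of the set of all positive multiples of involutory time-reversing Lorentz transformations and the set of all symmetric singular time-reversing null-cone bi-preserving maps. -/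

import Mathlib

open LinearMap (BilinForm)

namespace Superenergy

noncomputable section

variable {V : Type*} [AddCommGroup V] [Module ℝ V] {N : ℕ}

/-- The signs `+, -, …, -` of a Lorentzian metric in an orthonormal frame. -/
def sgn (i : Fin N) : ℝ := if (i : ℕ) = 0 then 1 else -1

/-- `e` is an orthonormal frame of the metric `g` of signature `+, -, …, -`. For `N ≥ 1`, a bilinear
form is a Lorentzian metric exactly when it has such a frame. -/
def IsLorentzFrame (g : BilinForm ℝ V) (e : Module.Basis (Fin N) ℝ V) : Prop :=
  ∀ i j, g (e i) (e j) = if i = j then sgn i else 0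

/-! ### Superenergy tensors of forms

All index contractions with the metric are carried out in an orthonormal frame `e`, where the
inverse metric is `∑ i, sgn i • e i ⊗ e i`; they do not depend on the frame. -/

/-- The tensor `(A ⊙ A)_{ab} = (-1)^(n-1) / (n-1)! A_{a c₂ … cₙ} A_b^{c₂ … cₙ}` of a form `A` with
`n = k + 1` indices. -/
def semiSquare (e : Module.Basis (Fin N) ℝ V) {k : ℕ} (A : V [⋀^Fin (k + 1)]→ₗ[ℝ] ℝ) :
    BilinForm ℝ V :=
  LinearMap.mk₂ ℝ
    (fun u v => (-1) ^ k / (k.factorial : ℝ) * ∑ c : Fin k → Fin N, (∏ i, sgn (c i)) *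
      (A.curryLeft u (fun i => e (c i)) * A.curryLeft v (fun i => e (c i))))
    (fun u u' v => by simp [add_mul, mul_add, Finset.sum_add_distrib])
    (fun r u v => by
      simp only [map_smul, AlternatingMap.smul_apply, smul_eq_mul, Finset.mul_sum]
      exact Finset.sum_congr rfl fun _ _ => by ring)
    (fun u v v' => by simp [mul_add, Finset.sum_add_distrib])
    (fun r u v => by
      simp only [map_smul, AlternatingMap.smul_apply, smul_eq_mul, Finset.mul_sum]
      exact Finset.sum_congr rfl fun _ _ => by ring)

theorem semiSquare_apply (e : Module.Basis (Fin N) ℝ V) {k : ℕ} (A : V [⋀^Fin (k + 1)]→ₗ[ℝ] ℝ)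
    (u v : V) :
    semiSquare e A u v = (-1) ^ k / (k.factorial : ℝ) * ∑ c : Fin k → Fin N, (∏ i, sgn (c i)) *
      (A (Fin.cons u (fun i => e (c i))) * A (Fin.cons v (fun i => e (c i)))) :=
  rfl

/-- The identification of `N` slots with `p` slots followed by `q` slots. -/
def splitSlots {p q : ℕ} (h : p + q = N) : Fin N ≃ Fin p ⊕ Fin q :=
  (finCongr h.symm).trans finSumFinEquiv.symm

/-- The `q`-form `v ↦ η (w₁, …, w_p, v₁, …, v_q)` got by filling the first `p` slots of an
`N`-form `η`. -/
def fillSlots {p q : ℕ} (h : p + q = N) (η : V [⋀^Fin N]→ₗ[ℝ] ℝ) (w : Fin p → V) :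
    V [⋀^Fin q]→ₗ[ℝ] ℝ :=
  { (MultilinearMap.currySum (N := fun _ : Fin p ⊕ Fin q => V)
      (η.toMultilinearMap.domDomCongr (splitSlots h))) w with
    map_eq_zero_of_eq' := fun v i j hv hij => by
      change η (fun s => Sum.elim w v (splitSlots h s)) = 0
      refine η.map_eq_zero_of_eq _ (i := (splitSlots h).symm (Sum.inr i))
        (j := (splitSlots h).symm (Sum.inr j)) (by simpa using hv) ?_
      intro hs
      exact hij (Sum.inr_injective ((splitSlots h).symm.injective hs)) }

theorem fillSlots_apply {p q : ℕ} (h : p + q = N) (η : V [⋀^Fin N]→ₗ[ℝ] ℝ) (w : Fin p → V)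
    (v : Fin q → V) : fillSlots h η w v = η (fun s => Sum.elim w v (splitSlots h s)) :=
  rfl

/-- The Hodge dual `(*Ω)_{b₁ … b_q} = (1 / p!) η_{a₁ … a_p b₁ … b_q} Ω^{a₁ … a_p}`, `q = N - p`, of
a `p`-form, where the volume form `η` is the determinant in the orthonormal frame. -/
def hodgeDual (e : Module.Basis (Fin N) ℝ V) {p q : ℕ} (h : p + q = N)
    (Ω : V [⋀^Fin p]→ₗ[ℝ] ℝ) : V [⋀^Fin q]→ₗ[ℝ] ℝ :=
  ((p.factorial : ℝ)⁻¹) • ∑ c : Fin p → Fin N,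
    ((∏ i, sgn (c i)) * Ω (fun i => e (c i))) • fillSlots h e.det (fun i => e (c i))

/-- The superenergy tensor of a `p`-form in dimension `N`, where `p = k + 1` and `q = N - p`:
`(1/2) (Ω ⊙ Ω + *Ω ⊙ *Ω)` if `1 ≤ p ≤ N - 1`, and `(1/2) f² g` if `p = N` and `Ω = f η`. -/
def superenergy (g : BilinForm ℝ V) (e : Module.Basis (Fin N) ℝ V) {k : ℕ} :
    {q : ℕ} → k + 1 + q = N → (V [⋀^Fin (k + 1)]→ₗ[ℝ] ℝ) → BilinForm ℝ V
  | 0, h, Ω => ((1 / 2 : ℝ) * Ω (fun i => e (Fin.cast h i)) ^ 2) • g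
  | _ + 1, h, Ω => (1 / 2 : ℝ) • (semiSquare e Ω + semiSquare e (hodgeDual e h Ω))

/-- The wedge product `ω₁ ∧ … ∧ ω_p` of 1-forms, `v ↦ det (ω_i (v_j))`. -/
def wedge {p : ℕ} (ω : Fin p → Module.Dual ℝ V) : V [⋀^Fin p]→ₗ[ℝ] ℝ :=
  Matrix.detRowAlternating.compLinearMap (LinearMap.pi ω)

/-- A `p`-form is simple if it is a wedge product of `p` linearly independent 1-forms. -/
def IsSimpleForm {p : ℕ} (Ω : V [⋀^Fin p]→ₗ[ℝ] ℝ) : Prop :=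
  ∃ ω : Fin p → Module.Dual ℝ V, LinearIndependent ℝ ω ∧ Ω = wedge ω

/-- The set of rank-2 superenergy tensors: those of arbitrary `p`-forms, `1 ≤ p ≤ N`. -/
def SE₂ (g : BilinForm ℝ V) (e : Module.Basis (Fin N) ℝ V) : Set (BilinForm ℝ V) :=
  {T | ∃ (k q : ℕ) (h : k + 1 + q = N) (Ω : V [⋀^Fin (k + 1)]→ₗ[ℝ] ℝ), T = superenergy g e h Ω}

/-- The set of superenergy tensors of simple `p`-forms, `1 ≤ p ≤ N`. -/
def SS (g : BilinForm ℝ V) (e : Module.Basis (Fin N) ℝ V) : Set (BilinForm ℝ V) :=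
  {T | ∃ (k q : ℕ) (h : k + 1 + q = N) (Ω : V [⋀^Fin (k + 1)]→ₗ[ℝ] ℝ),
    IsSimpleForm Ω ∧ T = superenergy g e h Ω}

/-! ### Maps preserving the null cone -/

/-- The linear map `k^a ↦ k^a T_a^b` of a rank-2 tensor `T_{ab}`. -/
def raise (e : Module.Basis (Fin N) ℝ V) (T : BilinForm ℝ V) : V →ₗ[ℝ] V :=
  ∑ i, sgn i • (T.flip (e i)).smulRight (e i)

theorem metric_raise {g : BilinForm ℝ V} {e : Module.Basis (Fin N) ℝ V} (he : IsLorentzFrame g e)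
    (T : BilinForm ℝ V) (u v : V) : g (raise e T u) v = T u v := by
  have hs : ∀ j : Fin N, sgn j * sgn j = 1 := fun j => by
    unfold sgn; split_ifs <;> norm_num
  have key : g (raise e T u) = T u := by
    refine e.ext fun j => ?_
    simp only [raise, LinearMap.sum_apply, LinearMap.smul_apply, LinearMap.smulRight_apply,
      BilinForm.flip_apply, map_sum, map_smul, smul_eq_mul]
    rw [Finset.sum_eq_single j]
    · rw [he j j, if_pos rfl]
      linear_combination (T u (e j)) * hs j
    · intro i _ hij
      rw [he i j, if_neg hij]; ring
    · simp
  rw [key]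

/-- The map sends null vectors to null vectors (the zero vector counts as null). -/
def IsNullConePreserving (g : BilinForm ℝ V) (f : V →ₗ[ℝ] V) : Prop :=
  ∀ k, g k k = 0 → g (f k) (f k) = 0

/-- `k` is a nonzero null vector that points to the future, for the time orientation in which the
timelike vector `τ` is future-pointing. -/
def IsFutureNull (g : BilinForm ℝ V) (τ k : V) : Prop :=
  g k k = 0 ∧ 0 < g τ k

/-- A null-cone preserving map that keeps the cone's time orientation. A singular map may send null
vectors to zero. -/
def IsOrthochronous (g : BilinForm ℝ V) (τ : V) (f : V →ₗ[ℝ] V) : Prop :=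
  IsNullConePreserving g f ∧ ∀ k, IsFutureNull g τ k → f k = 0 ∨ IsFutureNull g τ (f k)

/-- A null-cone preserving map that reverses the cone's time orientation. A singular map may send
null vectors to zero. -/
def IsTimeReversal (g : BilinForm ℝ V) (τ : V) (f : V →ₗ[ℝ] V) : Prop :=
  IsNullConePreserving g f ∧ ∀ k, IsFutureNull g τ k → f k = 0 ∨ IsFutureNull g τ (-f k)

/-- Both `k^a ↦ k^a T_a^b` and `k_b ↦ T_a^b k_b` send null vectors to null vectors. -/
def IsNullConeBiPreserving (g : BilinForm ℝ V) (e : Module.Basis (Fin N) ℝ V)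
    (T : BilinForm ℝ V) : Prop :=
  IsNullConePreserving g (raise e T) ∧ IsNullConePreserving g (raise e T.flip)

/-- The map is singular. -/
def IsSingular (f : V →ₗ[ℝ] V) : Prop := LinearMap.det f = 0

/-- A Lorentz transformation: a linear map that preserves the metric. -/
def IsLorentzTransformation (g : BilinForm ℝ V) (L : V →ₗ[ℝ] V) : Prop :=
  ∀ u v, g (L u) (L v) = g u v

/-- The map is its own inverse. -/
def IsInvolutory (L : V →ₗ[ℝ] V) : Prop := L ∘ₗ L = LinearMap.id

end

end Superenergy

/-!
For `Ω² = (-1)^(p-1) / p! Ω_{c₁ … c_p} Ω^{c₁ … c_p}` one has `*Ω ⊙ *Ω = Ω ⊙ Ω - Ω² g`, hence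
`T{Ω} = Ω ⊙ Ω - (1/2) Ω² g` in every degree and `T{*Ω} = T{Ω}`. In dimension `N ≤ 4` this leaves the
tensors of 1-forms, 2-forms and `N`-forms to be squared; for a 2-form `F` in dimension 4 one uses
that the maps of `F` and `*F` compose to a multiple of the identity. The result is the Rainich
condition `T ∘ T = l • id` with `l ≥ 0`, which together with `T(e₀, e₀) ≥ 0` characterizes the
symmetric tensors that preserve the null cone and its time orientation.

Conversely, let `T ≠ 0` satisfy these conditions. If `l > 0`, then `T` is a positive multiple of the
superenergy tensor of the wedge product of a basis of its `√l`-eigenspace; if `l = 0`, its range is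
spanned by a null vector, and `T` is a positive multiple of the superenergy tensor of the
corresponding 1-form.
-/

namespace Superenergy

noncomputable section

variable {V : Type*} [AddCommGroup V] [Module ℝ V] {N : ℕ} {g : BilinForm ℝ V}
  {e : Module.Basis (Fin N) ℝ V}

section Geometry

variable {τ σ : V}

theorem sgn_mul_self (i : Fin N) : sgn i * sgn i = 1 := by
  unfold sgn; split_ifs <;> norm_num

theorem sgn_zero [NeZero N] : sgn (0 : Fin N) = 1 := by
  simp [sgn]

theorem sgn_of_ne_zero [NeZero N] {i : Fin N} (hi : i ≠ 0) : sgn i = -1 := by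
  simp [sgn, Fin.val_eq_zero_iff, hi]

theorem IsLorentzFrame.comm (he : IsLorentzFrame g e) (u v : V) : g u v = g v u := by
  have h : g = g.flip := by
    refine e.ext fun i => e.ext fun j => ?_
    rw [BilinForm.flip_apply, he, he]
    by_cases h : i = j
    · rw [h]
    · rw [if_neg h, if_neg (Ne.symm h)]
  rw [h, BilinForm.flip_apply, ← h]

theorem IsLorentzFrame.sum_smul (he : IsLorentzFrame g e) (v : V) :
    ∑ i, (sgn i * g v (e i)) • e i = v := by
  have h : ∑ i, sgn i • (g.flip (e i)).smulRight (e i) = (LinearMap.id : V →ₗ[ℝ] V) := by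
    refine e.ext fun j => ?_
    simp only [LinearMap.sum_apply, LinearMap.smul_apply, LinearMap.smulRight_apply,
      BilinForm.flip_apply, LinearMap.id_apply]
    rw [Finset.sum_eq_single j]
    · rw [he, if_pos rfl, smul_smul, sgn_mul_self, one_smul]
    · intro i _ hij
      rw [he, if_neg (Ne.symm hij), zero_smul, smul_zero]
    · simp
  simpa [smul_smul] using LinearMap.congr_fun h v

theorem IsLorentzFrame.sum_smul_apply {M : Type*} [AddCommGroup M] [Module ℝ M]
    (he : IsLorentzFrame g e) (f : V →ₗ[ℝ] M) (v : V) :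
    ∑ i, (sgn i * g v (e i)) • f (e i) = f v := by
  conv_rhs => rw [← he.sum_smul v]
  simp only [map_sum, map_smul]

theorem IsLorentzFrame.sum_mul (he : IsLorentzFrame g e) (u v : V) :
    ∑ i, sgn i * (g u (e i) * g v (e i)) = g u v := by
  simpa only [smul_eq_mul, mul_assoc, he.comm v u] using he.sum_smul_apply (g v) u

theorem IsLorentzFrame.eq_of_forall (he : IsLorentzFrame g e) {u v : V}
    (h : ∀ w, g u w = g v w) : u = v := by
  rw [← he.sum_smul u, ← he.sum_smul v]
  exact Finset.sum_congr rfl fun i _ => by rw [h]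

theorem IsLorentzFrame.exists_dual (he : IsLorentzFrame g e) (ω : Module.Dual ℝ V) :
    ∃ w, ω = g w := by
  refine ⟨∑ i, (sgn i * ω (e i)) • e i, LinearMap.ext fun x => ?_⟩
  rw [← he.sum_smul_apply ω x, map_sum, LinearMap.sum_apply]
  refine Finset.sum_congr rfl fun i _ => ?_
  rw [map_smul, LinearMap.smul_apply, smul_eq_mul, smul_eq_mul, he.comm x]
  ring

theorem IsLorentzFrame.apply_zero_zero [NeZero N] (he : IsLorentzFrame g e) :
    g (e 0) (e 0) = 1 := by
  rw [he, if_pos rfl, sgn_zero]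

theorem IsLorentzFrame.eq_time_sub_space {n : ℕ} {e : Module.Basis (Fin (n + 1)) ℝ V}
    (he : IsLorentzFrame g e) (u v : V) :
    g u v = g u (e 0) * g v (e 0) - ∑ i : Fin n, g u (e i.succ) * g v (e i.succ) := by
  rw [← he.sum_mul, Fin.sum_univ_succ, sub_eq_add_neg, ← Finset.sum_neg_distrib]
  simp [sgn]

/-! ### Causal vectors -/

theorem IsLorentzFrame.eq_zero_of_orthogonal (he : IsLorentzFrame g e) (hτ : 0 < g τ τ) {x : V}
    (hx : g τ x = 0) (hxx : 0 ≤ g x x) : x = 0 := by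
  obtain _ | n := N
  · rw [← he.sum_smul x, Finset.univ_eq_empty, Finset.sum_empty]
  have cauchy := Finset.sum_mul_sq_le_sq_mul_sq Finset.univ (fun i : Fin n => g τ (e i.succ))
    (fun i : Fin n => g x (e i.succ))
  rw [he.eq_time_sub_space] at hτ hx hxx
  simp only [← pow_two] at hτ hxx
  rw [← sub_eq_zero.mp hx, mul_pow] at cauchy
  set A := ∑ i : Fin n, g τ (e i.succ) ^ 2
  set B := ∑ i : Fin n, g x (e i.succ) ^ 2 with hB
  have hA : 0 ≤ A := Finset.sum_nonneg fun i _ => sq_nonneg _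
  have hB_zero : B = 0 := by
    have : 0 ≤ B := Finset.sum_nonneg fun i _ => sq_nonneg _
    nlinarith
  have time_zero : g x (e 0) = 0 := by
    rw [hB_zero, mul_zero] at cauchy
    have : 0 < g τ (e 0) ^ 2 := by linarith
    exact pow_eq_zero_iff two_ne_zero |>.mp (by nlinarith [sq_nonneg (g x (e 0))])
  have space_zero : ∀ i : Fin n, g x (e i.succ) = 0 := fun i =>
    pow_eq_zero_iff two_ne_zero |>.mp
      ((Finset.sum_eq_zero_iff_of_nonneg fun i _ => sq_nonneg _).mp hB_zero i (Finset.mem_univ i))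
  rw [← he.sum_smul x]
  refine Finset.sum_eq_zero fun i _ => ?_
  refine Fin.cases ?_ (fun j => ?_) i
  · rw [time_zero, mul_zero, zero_smul]
  · rw [space_zero, mul_zero, zero_smul]

/-- `x` is zero or a future-pointing timelike or null vector, for the time orientation given by the
timelike vector `τ`. -/
def IsFutureCausal (g : BilinForm ℝ V) (τ x : V) : Prop :=
  0 ≤ g x x ∧ 0 ≤ g τ x

theorem IsFutureNull.isFutureCausal {k : V} (hk : IsFutureNull g τ k) : IsFutureCausal g τ k :=
  ⟨hk.1.ge, hk.2.le⟩

theorem IsOrthochronous.isFutureCausal {f : V →ₗ[ℝ] V} (hf : IsOrthochronous g τ f) {k : V}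
    (hk : IsFutureNull g τ k) : IsFutureCausal g τ (f k) := by
  obtain h | h := hf.2 k hk
  · simp [h, IsFutureCausal]
  · exact h.isFutureCausal

theorem IsFutureCausal.metric_nonneg (he : IsLorentzFrame g e) (hτ : 0 < g τ τ) {x y : V}
    (hx : IsFutureCausal g τ x) (hy : IsFutureCausal g τ y) : 0 ≤ g x y := by
  obtain ⟨hxx, hx⟩ := hx
  obtain ⟨hyy, hy⟩ := hy
  obtain hx | hx := hx.eq_or_lt
  · simp [he.eq_zero_of_orthogonal hτ hx.symm hxx]
  obtain hy | hy := hy.eq_or_lt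
  · simp [he.eq_zero_of_orthogonal hτ hy.symm hyy]
  by_contra! hlt
  have orthogonal : g τ (g τ y • x - g τ x • y) = 0 := by simp; ring
  have hz : 0 < g (g τ y • x - g τ x • y) (g τ y • x - g τ x • y) := by
    simp only [map_sub, map_smul, LinearMap.sub_apply, LinearMap.smul_apply, smul_eq_mul,
      he.comm y x]
    nlinarith [mul_pos (mul_pos hx hy) (neg_pos.mpr hlt), mul_nonneg (sq_nonneg (g τ y)) hxx,
      mul_nonneg (sq_nonneg (g τ x)) hyy]
  rw [he.eq_zero_of_orthogonal hτ orthogonal hz.le] at hz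
  simp at hz

theorem IsFutureNull.congr (he : IsLorentzFrame g e) (hτ : 0 < g τ τ) (hσ : 0 < g σ σ)
    (hτσ : 0 < g τ σ) {k : V} (hk : IsFutureNull g τ k) : IsFutureNull g σ k := by
  have hσk : 0 ≤ g σ k := IsFutureCausal.metric_nonneg he hτ ⟨hσ.le, hτσ.le⟩ hk.isFutureCausal
  refine ⟨hk.1, hσk.lt_of_ne fun h => hk.2.ne' ?_⟩
  rw [he.eq_zero_of_orthogonal hσ h.symm hk.1.ge, map_zero]

theorem IsOrthochronous.neg_orientation {f : V →ₗ[ℝ] V} (h : IsOrthochronous g τ f) :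
    IsOrthochronous g (-τ) f := by
  refine ⟨h.1, fun k hk => ?_⟩
  have hk' : IsFutureNull g τ (-k) := ⟨by simpa using hk.1, by simpa using hk.2⟩
  exact (h.2 _ hk').imp (fun h0 => by simpa using h0) fun h1 =>
    ⟨by simpa using h1.1, by simpa using h1.2⟩

theorem IsOrthochronous.congr (he : IsLorentzFrame g e) (hτ : 0 < g τ τ) (hσ : 0 < g σ σ)
    {f : V →ₗ[ℝ] V} (h : IsOrthochronous g τ f) : IsOrthochronous g σ f := by
  have same_cone : ∀ ρ, 0 < g ρ ρ → 0 < g τ ρ → IsOrthochronous g ρ f := fun ρ hρ hτρ =>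
    ⟨h.1, fun k hk => (h.2 k (hk.congr he hρ hτ (by rwa [he.comm]))).imp_right
      fun hk' => hk'.congr he hτ hρ hτρ⟩
  rcases lt_trichotomy (g τ σ) 0 with h1 | h1 | h1
  · simpa using (same_cone (-σ) (by simpa using hσ) (by simpa using h1)).neg_orientation
  · rw [he.eq_zero_of_orthogonal hτ h1 hσ.le] at hσ
    simp at hσ
  · exact same_cone σ hσ h1

/-! ### Symmetric forms determined by the null cone -/

section NullCone

variable [NeZero N] {B : BilinForm ℝ V}

theorem IsLorentzFrame.apply_of_null (he : IsLorentzFrame g e) (hB : B.IsSymm)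
    (h : ∀ k, g k k = 0 → B k k = 0) {i : Fin N} (hi : i ≠ 0) :
    B (e i) (e i) = -B (e 0) (e 0) ∧ B (e 0) (e i) = 0 := by
  have plus := h (e 0 + e i) (by simp [he _ _, sgn_zero, sgn_of_ne_zero hi, hi, hi.symm])
  have minus := h (e 0 - e i) (by simp [he _ _, sgn_zero, sgn_of_ne_zero hi, hi, hi.symm])
  simp only [map_add, map_sub, LinearMap.add_apply, LinearMap.sub_apply, hB.eq (e i) (e 0)]
    at plus minus
  constructor <;> linarith

theorem IsLorentzFrame.apply_of_null_of_ne (he : IsLorentzFrame g e) (hB : B.IsSymm)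
    (h : ∀ k, g k k = 0 → B k k = 0) {i j : Fin N} (hi : i ≠ 0) (hj : j ≠ 0) (hij : i ≠ j) :
    B (e i) (e j) = 0 := by
  have pythagoras := h ((5 : ℝ) • e 0 + (3 : ℝ) • e i + (4 : ℝ) • e j) (by
    simp [he _ _, sgn_zero, sgn_of_ne_zero hi, sgn_of_ne_zero hj, hi, hj, hij, hi.symm, hj.symm,
      hij.symm]
    norm_num)
  simp only [map_add, map_smul, LinearMap.add_apply, LinearMap.smul_apply, smul_eq_mul,
    hB.eq (e i) (e 0), hB.eq (e j) (e 0), hB.eq (e j) (e i), (he.apply_of_null hB h hi).2,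
    (he.apply_of_null hB h hj).2] at pythagoras
  linarith [(he.apply_of_null hB h hi).1, (he.apply_of_null hB h hj).1]

theorem IsLorentzFrame.eq_smul_of_null (he : IsLorentzFrame g e) (hB : B.IsSymm)
    (h : ∀ k, g k k = 0 → B k k = 0) : B = B (e 0) (e 0) • g := by
  refine e.ext fun i => e.ext fun j => ?_
  rw [LinearMap.smul_apply, LinearMap.smul_apply, he, smul_eq_mul]
  by_cases hi : i = 0 <;> by_cases hj : j = 0
  · simp [hi, hj, sgn_zero]
  · simp [hi, (he.apply_of_null hB h hj).2, Ne.symm hj]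
  · simp [hj, hB.eq (e i) (e 0), (he.apply_of_null hB h hi).2, hi]
  by_cases hij : i = j
  · simp [← hij, (he.apply_of_null hB h hi).1, sgn_of_ne_zero hi]
  · simp [he.apply_of_null_of_ne hB h hi hj hij, hij]

end NullCone

theorem metric_raise_comm (he : IsLorentzFrame g e) {T : BilinForm ℝ V} (hT : T.IsSymm) (u v : V) :
    g (raise e T u) v = g u (raise e T v) := by
  rw [metric_raise he, he.comm, metric_raise he, hT.eq]

end Geometry

/-! ### Contractions of forms -/

section Contraction

variable {n : ℕ}

theorem sum_insertNth {ι : Type*} [Fintype ι] (i : Fin (n + 1)) (f : (Fin (n + 1) → ι) → ℝ) :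
    ∑ c, f c = ∑ a, ∑ c : Fin n → ι, f (i.insertNth a c) := by
  rw [← Fintype.sum_prod_type' (f := fun a c => f (i.insertNth a c))]
  exact (Fintype.sum_equiv (Fin.insertNthEquiv (fun _ => ι) i) _ _ fun _ => rfl).symm

theorem prod_sgn_insertNth (i : Fin (n + 1)) (a : Fin N) (c : Fin n → Fin N) :
    ∏ j, sgn (i.insertNth (α := fun _ => Fin N) a c j) = sgn a * ∏ j, sgn (c j) := by
  rw [Fin.prod_univ_succAbove _ i]
  simp only [Fin.insertNth_apply_same, Fin.insertNth_apply_succAbove]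

theorem frame_insertNth (e : Module.Basis (Fin N) ℝ V) (i : Fin (n + 1)) (a : Fin N)
    (c : Fin n → Fin N) :
    (fun j => e (i.insertNth (α := fun _ => Fin N) a c j)) =
      i.insertNth (α := fun _ => V) (e a) (fun j => e (c j)) := by
  refine funext fun j => ?_
  cases j using Fin.succAboveCases i <;> simp

theorem sum_form_apply {ι : Type*} (s : Finset ι) (F : ι → V [⋀^Fin n]→ₗ[ℝ] ℝ) (v : Fin n → V) :
    (∑ i ∈ s, F i) v = ∑ i ∈ s, F i v :=
  map_sum (AddMonoidHom.mk' (fun A : V [⋀^Fin n]→ₗ[ℝ] ℝ => A v) fun _ _ => rfl) F s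

theorem neg_one_pow_sq (i : ℕ) : ((-1 : ℝ) ^ i) ^ 2 = 1 := by
  rw [← pow_mul, pow_mul', neg_one_sq, one_pow]

/-- The full contraction `A_{c₁ … cₙ} B^{c₁ … cₙ}` of two `n`-forms, computed in the orthonormal
frame `e`. -/
def formInner (e : Module.Basis (Fin N) ℝ V) : BilinForm ℝ (V [⋀^Fin n]→ₗ[ℝ] ℝ) :=
  LinearMap.mk₂ ℝ
    (fun A B => ∑ c : Fin n → Fin N, (∏ i, sgn (c i)) *
      (A (fun i => e (c i)) * B (fun i => e (c i))))
    (fun A A' B => by simp [add_mul, mul_add, Finset.sum_add_distrib])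
    (fun r A B => by simp only [AlternatingMap.smul_apply, smul_eq_mul, Finset.mul_sum]; grind)
    (fun A B B' => by simp [mul_add, Finset.sum_add_distrib])
    (fun r A B => by simp only [AlternatingMap.smul_apply, smul_eq_mul, Finset.mul_sum]; grind)

theorem formInner_apply (A B : V [⋀^Fin n]→ₗ[ℝ] ℝ) :
    formInner e A B = ∑ c : Fin n → Fin N, (∏ i, sgn (c i)) *
      (A (fun i => e (c i)) * B (fun i => e (c i))) :=
  rfl

theorem formInner_comm (A B : V [⋀^Fin n]→ₗ[ℝ] ℝ) : formInner e A B = formInner e B A := by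
  simp only [formInner_apply, mul_comm (A _)]

theorem formInner_zero_forms (A B : V [⋀^Fin 0]→ₗ[ℝ] ℝ) : formInner e A B = A ![] * B ![] := by
  simp [formInner_apply, Matrix.empty_eq]

theorem map_insertNth_eq (A : V [⋀^Fin (n + 1)]→ₗ[ℝ] ℝ) (i : Fin (n + 1)) (u : V) (w : Fin n → V) :
    A (i.insertNth (α := fun _ => V) u w) = (-1) ^ (i : ℕ) * A.curryLeft u w := by
  rw [A.map_insertNth, zsmul_eq_mul, AlternatingMap.curryLeft_apply_apply]
  simp

theorem formInner_succ (A B : V [⋀^Fin (n + 1)]→ₗ[ℝ] ℝ) :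
    formInner e A B = ∑ a, sgn a * formInner e (A.curryLeft (e a)) (B.curryLeft (e a)) := by
  rw [formInner_apply, sum_insertNth 0]
  simp only [prod_sgn_insertNth, frame_insertNth, map_insertNth_eq, formInner_apply, Finset.mul_sum]
  simp [mul_assoc]

theorem semiSquare_eq (A : V [⋀^Fin (n + 1)]→ₗ[ℝ] ℝ) (u v : V) :
    semiSquare e A u v =
      (-1) ^ n / (n.factorial : ℝ) * formInner e (A.curryLeft u) (A.curryLeft v) :=
  rfl

theorem sum_update_eq_formInner (he : IsLorentzFrame g e) (A B : V [⋀^Fin (n + 1)]→ₗ[ℝ] ℝ)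
    (u v : V) (i : Fin (n + 1)) :
    ∑ c : Fin (n + 1) → Fin N, (∏ j, sgn (c j)) * (A (fun j => e (c j)) *
      (g v (e (c i)) * B (Function.update (fun j => e (c j)) i u))) =
    formInner e (A.curryLeft v) (B.curryLeft u) := by
  have expand : formInner e (A.curryLeft v) (B.curryLeft u) =
      ∑ a, sgn a * g v (e a) * formInner e (A.curryLeft (e a)) (B.curryLeft u) :=
    (he.sum_smul_apply ((formInner e).flip (B.curryLeft u) ∘ₗ A.curryLeft) v).symm
  rw [expand, sum_insertNth i]
  refine Finset.sum_congr rfl fun a _ => ?_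
  simp only [prod_sgn_insertNth, frame_insertNth, Fin.insertNth_apply_same, Fin.update_insertNth,
    map_insertNth_eq, formInner_apply, Finset.mul_sum]
  refine Finset.sum_congr rfl fun c _ => ?_
  linear_combination (sgn a * (∏ j, sgn (c j)) * g v (e a) *
    A.curryLeft (e a) (fun j => e (c j)) * B.curryLeft u fun j => e (c j)) * neg_one_pow_sq i

end Contraction

/-! ### Wedge products -/

section Wedge

variable {n : ℕ}

theorem wedge_apply (ω : Fin n → Module.Dual ℝ V) (v : Fin n → V) :
    wedge ω v = (Matrix.of fun i j => ω j (v i)).det :=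
  rfl

theorem wedge_metric_comm (he : IsLorentzFrame g e) (v w : Fin n → V) :
    wedge (fun i => g (v i)) w = wedge (fun i => g (w i)) v := by
  rw [wedge_apply, wedge_apply, ← Matrix.det_transpose]
  simp only [he.comm (w _)]
  rfl

theorem wedge_comp_perm (σ : Equiv.Perm (Fin n)) (ω : Fin n → Module.Dual ℝ V) (v : Fin n → V) :
    wedge (fun i => ω (σ i)) (fun i => v (σ i)) = wedge ω v :=
  Matrix.det_submatrix_equiv_self σ (Matrix.of fun i j => ω j (v i))

theorem wedge_cons (α : Module.Dual ℝ V) (ω : Fin n → Module.Dual ℝ V) (v : Fin (n + 1) → V) :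
    wedge (Fin.cons α ω : Fin (n + 1) → Module.Dual ℝ V) v =
      ∑ i : Fin (n + 1), (-1) ^ (i : ℕ) * α (v i) * wedge ω (i.removeNth v) := by
  rw [wedge_apply, Matrix.det_succ_column_zero]
  rfl

theorem curryLeft_wedge (ω : Fin (n + 1) → Module.Dual ℝ V) (u : V) :
    (wedge ω).curryLeft u =
      ∑ i : Fin (n + 1), ((-1) ^ (i : ℕ) * ω i u) • wedge (i.removeNth ω) := by
  ext v
  rw [AlternatingMap.curryLeft_apply_apply, wedge_apply, Matrix.det_succ_row_zero, sum_form_apply]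
  rfl

theorem wedge_update (ω : Fin n → Module.Dual ℝ V) (w : Fin n → V) (i : Fin n) (u : V) :
    wedge ω (Function.update w i u) =
      (-1) ^ (i : ℕ) * wedge ω (i.succ.removeNth (Fin.cons u w : Fin (n + 1) → V)) := by
  obtain _ | m := n
  · exact i.elim0
  rw [← Fin.insertNth_removeNth, map_insertNth_eq, AlternatingMap.curryLeft_apply_apply]
  congr 2
  refine funext fun j => Fin.cases ?_ (fun k => ?_) j
  · simp [Fin.removeNth_apply]
  · simp [Fin.removeNth_apply]

theorem wedge_cons_cons (α : Module.Dual ℝ V) (ω : Fin n → Module.Dual ℝ V) (u : V)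
    (w : Fin n → V) :
    wedge (Fin.cons α ω : Fin (n + 1) → Module.Dual ℝ V) (Fin.cons u w : Fin (n + 1) → V) =
      α u * wedge ω w - ∑ i, α (w i) * wedge ω (Function.update w i u) := by
  rw [wedge_cons, Fin.sum_univ_succ, sub_eq_add_neg, ← Finset.sum_neg_distrib]
  congr 1
  · simp
  · refine Finset.sum_congr rfl fun i _ => ?_
    rw [wedge_update, Fin.cons_succ, Fin.val_succ, pow_succ]
    ring

theorem wedge_snoc_snoc (α : Module.Dual ℝ V) (ω : Fin n → Module.Dual ℝ V) (u : V)
    (w : Fin n → V) :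
    wedge (Fin.snoc ω α : Fin (n + 1) → Module.Dual ℝ V) (Fin.snoc w u : Fin (n + 1) → V) =
      α u * wedge ω w - ∑ i, α (w i) * wedge ω (Function.update w i u) := by
  rw [← wedge_cons_cons, ← wedge_comp_perm (finRotate (n + 1)) (Fin.cons α ω),
    Fin.snoc_eq_cons_rotate, Fin.snoc_eq_cons_rotate]

theorem sum_wedge_snoc_snoc (he : IsLorentzFrame g e) (z w : Fin n → V) :
    ∑ a, sgn a * wedge (fun i => g ((Fin.snoc z (e a) : Fin (n + 1) → V) i))
      (Fin.snoc w (e a) : Fin (n + 1) → V) = (N - n) * wedge (fun i => g (z i)) w := by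
  set ω : Fin n → Module.Dual ℝ V := fun i => g (z i)
  have snoc_comp : ∀ a, (fun i => g ((Fin.snoc z (e a) : Fin (n + 1) → V) i)) =
      (Fin.snoc ω (g (e a)) : Fin (n + 1) → Module.Dual ℝ V) := fun a =>
    Fin.comp_snoc g z (e a)
  have trace : ∑ a, sgn a * (g (e a) (e a) * wedge ω w) = N * wedge ω w := by
    simp [he _ _, ← mul_assoc, sgn_mul_self]
  have update_self : ∀ i, ∑ a, sgn a * (g (e a) (w i) * wedge ω (Function.update w i (e a))) =
      wedge ω w := fun i => by
    have h := he.sum_smul_apply ((wedge ω).toMultilinearMap.toLinearMap w i) (w i)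
    simp only [MultilinearMap.toLinearMap_apply, AlternatingMap.coe_multilinearMap,
      Function.update_eq_self, smul_eq_mul, mul_assoc] at h
    simpa only [he.comm (e _)] using h
  simp only [snoc_comp, wedge_snoc_snoc, mul_sub, Finset.sum_sub_distrib, trace, Finset.mul_sum]
  rw [Finset.sum_comm]
  simp only [update_self]
  simp [sub_mul]

theorem sum_mul_apply_frame (he : IsLorentzFrame g e) (A : V [⋀^Fin n]→ₗ[ℝ] ℝ) (w : Fin n → V) :
    ∑ c : Fin n → Fin N, (∏ i, sgn (c i)) * ((∏ i, g (w i) (e (c i))) * A (fun i => e (c i))) =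
      A w := by
  conv_rhs => rw [← funext fun i => he.sum_smul (w i)]
  rw [← AlternatingMap.coe_multilinearMap, MultilinearMap.map_sum]
  refine Finset.sum_congr rfl fun c _ => ?_
  rw [MultilinearMap.map_smul_univ, Finset.prod_mul_distrib, smul_eq_mul, mul_assoc]

theorem formInner_wedge (he : IsLorentzFrame g e) (A : V [⋀^Fin n]→ₗ[ℝ] ℝ) (w : Fin n → V) :
    formInner e A (wedge fun i => g (w i)) = n.factorial * A w := by
  have permuted : ∀ σ : Equiv.Perm (Fin n), ∑ c : Fin n → Fin N, (∏ i, sgn (c i)) *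
      (A (fun i => e (c i)) * (Equiv.Perm.sign σ * ∏ i, g (w i) (e (c (σ i))))) = A w := fun σ => by
    rw [← sum_mul_apply_frame he A w]
    refine Fintype.sum_equiv (Equiv.arrowCongr σ.symm (Equiv.refl (Fin N))) _ _ fun c => ?_
    have hA : A (fun i => e (c (σ i))) = Equiv.Perm.sign σ * A (fun i => e (c i)) := by
      have h := A.map_perm (fun i => e (c i)) σ
      rwa [Units.smul_def, zsmul_eq_mul] at h
    change _ = (∏ i, sgn (c (σ i))) *
      ((∏ i, g (w i) (e (c (σ i)))) * A (fun i => e (c (σ i))))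
    rw [Equiv.prod_comp σ fun i => sgn (c i), hA]
    ring
  simp only [formInner_apply, wedge_apply, Matrix.det_apply', Matrix.of_apply, Finset.mul_sum]
  rw [Finset.sum_comm, Finset.sum_congr rfl fun σ _ => permuted σ]
  simp [Fintype.card_perm]

end Wedge

/-! ### Hodge duality -/

section Hodge

variable {m n p q r k j : ℕ}

theorem IsLorentzFrame.apply_repr (he : IsLorentzFrame g e) (u : V) (a : Fin N) :
    g u (e a) = sgn a * e.repr u a := by
  conv_lhs => rw [← e.sum_repr u]
  simp only [map_sum, map_smul, LinearMap.sum_apply, LinearMap.smul_apply, he _ _]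
  simp [mul_comm]

theorem prod_sgn (h : p + 1 + q = N) : ∏ i : Fin N, sgn i = (-1) ^ p * (-1) ^ q := by
  obtain rfl : N = p + q + 1 := by omega
  simp [Fin.prod_univ_succ, sgn, pow_add]

theorem prod_sgn_mul_self (c : Fin n → Fin N) : (∏ i, sgn (c i)) * ∏ i, sgn (c i) = 1 := by
  simp [← Finset.prod_mul_distrib, sgn_mul_self]

theorem det_mul_det (he : IsLorentzFrame g e) (w z : Fin N → V) :
    e.det w * e.det z = (∏ i : Fin N, sgn i) * wedge (fun i => g (z i)) w := by
  have gram : (Matrix.of fun i j => g (z j) (w i)) =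
      (e.toMatrix w).transpose * Matrix.diagonal sgn * e.toMatrix z := by
    ext i j
    rw [Matrix.of_apply, ← he.sum_mul, Matrix.mul_apply]
    refine Finset.sum_congr rfl fun a _ => ?_
    rw [Matrix.mul_diagonal, Matrix.transpose_apply, e.toMatrix_apply, e.toMatrix_apply,
      he.apply_repr, he.apply_repr]
    linear_combination (sgn a * e.repr (z j) a * e.repr (w i) a) * sgn_mul_self a
  rw [wedge_apply, gram, Matrix.det_mul, Matrix.det_mul, Matrix.det_transpose, Matrix.det_diagonal,
    e.det_apply, e.det_apply]
  have hsign : (∏ i : Fin N, sgn i) * ∏ i : Fin N, sgn i = 1 := prod_sgn_mul_self id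
  linear_combination (-(e.toMatrix w).det * (e.toMatrix z).det) * hsign

theorem fillSlots_eq_append (h : p + q = N) (η : V [⋀^Fin N]→ₗ[ℝ] ℝ) (w : Fin p → V)
    (v : Fin q → V) : fillSlots h η w v = η (Fin.append w v ∘ Fin.cast h.symm) := by
  rw [fillSlots_apply]
  congr 1
  funext s
  obtain ⟨x, hx⟩ := finSumFinEquiv.surjective (Fin.cast h.symm s)
  rw [Function.comp_apply, ← hx, splitSlots, Equiv.trans_apply, finCongr_apply, ← hx,
    Equiv.symm_apply_apply]
  cases x <;> simp

theorem curryLeft_fillSlots (h : p + (q + 1) = N) (h' : p + 1 + q = N) (η : V [⋀^Fin N]→ₗ[ℝ] ℝ)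
    (w : Fin p → V) (u : V) :
    (fillSlots h η w).curryLeft u = fillSlots h' η (Fin.snoc w u) := by
  ext v
  rw [AlternatingMap.curryLeft_apply_apply, fillSlots_eq_append, fillSlots_eq_append,
    Fin.append_left_snoc]
  rfl

theorem formInner_fillSlots (he : IsLorentzFrame g e) (h : m + r = N) (w z : Fin m → V) :
    formInner e (fillSlots h e.det w) (fillSlots h e.det z) =
      (∏ i : Fin N, sgn i) * r.factorial * wedge (fun i => g (z i)) w := by
  induction r generalizing m with
  | zero =>
    have hm : m = N := h
    subst hm
    have full : ∀ w : Fin m → V, fillSlots h e.det w ![] = e.det w := fun w => by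
      rw [fillSlots_eq_append]
      congr 1
      exact funext fun i => Fin.append_left w ![] i
    rw [formInner_zero_forms, full w, full z, det_mul_det he, Nat.factorial_zero]
    simp
  | succ r ih =>
    have h' : m + 1 + r = N := by omega
    have hN : (N : ℝ) = m + (r + 1) := by exact_mod_cast h.symm
    simp only [formInner_succ (fillSlots h _ _), curryLeft_fillSlots h h', ih h', ← mul_assoc,
      mul_comm (sgn _) ((∏ i : Fin N, sgn i) * _)]
    simp only [mul_assoc, ← Finset.mul_sum, sum_wedge_snoc_snoc he z w, hN, Nat.factorial_succ]
    push_cast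
    ring

theorem formInner_curryLeft_fillSlots (he : IsLorentzFrame g e) (h : m + (r + 1) = N)
    (w z : Fin m → V) (u v : V) :
    formInner e ((fillSlots h e.det w).curryLeft u) ((fillSlots h e.det z).curryLeft v) =
      (∏ i : Fin N, sgn i) * r.factorial * (g v u * wedge (fun i => g (w i)) z -
        ∑ i, g v (w i) * wedge (fun j => g (Function.update w i u j)) z) := by
  have h' : m + 1 + r = N := by omega
  rw [curryLeft_fillSlots h h', curryLeft_fillSlots h h', formInner_fillSlots he h',
    show (fun i => g ((Fin.snoc z v : Fin (m + 1) → V) i)) =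
      (Fin.snoc (fun i => g (z i)) (g v) : Fin (m + 1) → Module.Dual ℝ V) from Fin.comp_snoc g z v,
    wedge_snoc_snoc]
  simp only [wedge_metric_comm he z]

theorem curryLeft_hodgeDual (h : p + (r + 1) = N) (A : V [⋀^Fin p]→ₗ[ℝ] ℝ) (u : V) :
    (hodgeDual e h A).curryLeft u = (p.factorial : ℝ)⁻¹ • ∑ c : Fin p → Fin N,
      ((∏ i, sgn (c i)) * A (fun i => e (c i))) •
        (fillSlots h e.det (fun i => e (c i))).curryLeft u := by
  ext v
  simp only [hodgeDual, AlternatingMap.curryLeft_apply_apply, AlternatingMap.smul_apply,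
    sum_form_apply]

theorem formInner_curryLeft_fillSlots_hodgeDual (he : IsLorentzFrame g e) (h : p + (r + 1) = N)
    (B : V [⋀^Fin p]→ₗ[ℝ] ℝ) (w : Fin p → V) (u v : V) :
    formInner e ((fillSlots h e.det w).curryLeft u) ((hodgeDual e h B).curryLeft v) =
      (∏ i : Fin N, sgn i) * r.factorial *
        (g v u * B w - ∑ i, g v (w i) * B (Function.update w i u)) := by
  have contract : ∀ w : Fin p → V, (p.factorial : ℝ)⁻¹ * ∑ d : Fin p → Fin N, (∏ i, sgn (d i)) *
      (B (fun i => e (d i)) * wedge (fun i => g (w i)) fun i => e (d i)) = B w := fun w => by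
    rw [← formInner_apply, formInner_wedge he, inv_mul_cancel_left₀ (by positivity)]
  simp only [curryLeft_hodgeDual, map_smul, map_sum, smul_eq_mul, formInner_curryLeft_fillSlots he]
  rw [← contract w, Finset.sum_congr rfl fun i _ =>
    congrArg (g v (w i) * ·) (contract (Function.update w i u)).symm]
  simp only [Finset.mul_sum, mul_sub, Finset.sum_sub_distrib]
  congr 1
  · exact Finset.sum_congr rfl fun d _ => by ring
  · rw [Finset.sum_comm]
    exact Finset.sum_congr rfl fun i _ => Finset.sum_congr rfl fun d _ => by ring

theorem formInner_curryLeft_hodgeDual (he : IsLorentzFrame g e) (h : k + 1 + (r + 1) = N)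
    (A B : V [⋀^Fin (k + 1)]→ₗ[ℝ] ℝ) (u v : V) :
    formInner e ((hodgeDual e h A).curryLeft u) ((hodgeDual e h B).curryLeft v) =
      (∏ i : Fin N, sgn i) * r.factorial / (k + 1).factorial *
        (g u v * formInner e A B - (k + 1) * formInner e (A.curryLeft v) (B.curryLeft u)) := by
  have updates : ∑ i : Fin (k + 1), ∑ c : Fin (k + 1) → Fin N, (∏ j, sgn (c j)) *
      (A (fun j => e (c j)) * (g v (e (c i)) * B (Function.update (fun j => e (c j)) i u))) =
      (k + 1) * formInner e (A.curryLeft v) (B.curryLeft u) := by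
    simp [sum_update_eq_formInner he]
  rw [curryLeft_hodgeDual h A, map_smul, map_sum, LinearMap.smul_apply, LinearMap.sum_apply,
    ← updates, Finset.sum_comm, formInner_apply]
  simp only [map_smul, LinearMap.smul_apply, smul_eq_mul, he.comm u v,
    formInner_curryLeft_fillSlots_hodgeDual he, Finset.mul_sum, ← Finset.sum_sub_distrib]
  refine Finset.sum_congr rfl fun c _ => ?_
  simp only [mul_sub, Finset.mul_sum]
  congr 1
  · ring
  · exact Finset.sum_congr rfl fun i _ => by ring

theorem formInner_hodgeDual (he : IsLorentzFrame g e) (h : k + 1 + (r + 1) = N)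
    (A B : V [⋀^Fin (k + 1)]→ₗ[ℝ] ℝ) :
    formInner e (hodgeDual e h A) (hodgeDual e h B) =
      (∏ i : Fin N, sgn i) * (r + 1).factorial / (k + 1).factorial * formInner e A B := by
  have hN : (N : ℝ) = k + 1 + (r + 1) := by exact_mod_cast h.symm
  have trace : ∑ a, sgn a * (g (e a) (e a) * formInner e A B -
      (k + 1) * formInner e (A.curryLeft (e a)) (B.curryLeft (e a))) =
      (r + 1) * formInner e A B := by
    simp only [mul_sub, Finset.sum_sub_distrib, mul_left_comm (sgn _) (k + 1 : ℝ),
      ← Finset.mul_sum, ← formInner_succ]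
    simp only [he _ _, if_pos, ← mul_assoc, sgn_mul_self, one_mul, Finset.sum_const,
      Finset.card_univ, Fintype.card_fin, nsmul_eq_mul, hN]
    ring
  rw [formInner_succ]
  simp only [formInner_curryLeft_hodgeDual he, mul_left_comm (sgn _), ← Finset.mul_sum, trace]
  rw [Nat.factorial_succ r]
  push_cast
  ring

end Hodge

/-! ### Superenergy tensors -/

section Tensor

variable {n k q r : ℕ}

/-- The square `(-1)^k / (k+1)! A_{c₀ … c_k} A^{c₀ … c_k}` of a form `A` with `k + 1` indices,
normalized as `semiSquare`, of which it is the trace divided by `k + 1`. -/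
def formSq (e : Module.Basis (Fin N) ℝ V) (A : V [⋀^Fin (k + 1)]→ₗ[ℝ] ℝ) : ℝ :=
  (-1) ^ k / ((k + 1).factorial : ℝ) * formInner e A A

theorem semiSquare_hodgeDual (he : IsLorentzFrame g e) (h : k + 1 + (r + 1) = N)
    (Ω : V [⋀^Fin (k + 1)]→ₗ[ℝ] ℝ) :
    semiSquare e (hodgeDual e h Ω) = semiSquare e Ω - formSq e Ω • g := by
  ext u v
  rw [LinearMap.sub_apply, LinearMap.sub_apply, LinearMap.smul_apply, LinearMap.smul_apply,
    smul_eq_mul, semiSquare_eq, semiSquare_eq, formInner_curryLeft_hodgeDual he, prod_sgn h, formSq,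
    formInner_comm (Ω.curryLeft v), Nat.factorial_succ k]
  have hr : (r.factorial : ℝ) ≠ 0 := by positivity
  have hk : (k.factorial : ℝ) ≠ 0 := by positivity
  push_cast
  field_simp
  linear_combination ((k + 1) * formInner e (Ω.curryLeft u) (Ω.curryLeft v) -
    g u v * formInner e Ω Ω) * neg_one_pow_sq r

theorem formSq_hodgeDual (he : IsLorentzFrame g e) (h : k + 1 + (r + 1) = N)
    (Ω : V [⋀^Fin (k + 1)]→ₗ[ℝ] ℝ) : formSq e (hodgeDual e h Ω) = -formSq e Ω := by
  rw [formSq, formSq, formInner_hodgeDual he, prod_sgn h]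
  have hr : ((r + 1).factorial : ℝ) ≠ 0 := by positivity
  field_simp
  linear_combination -formInner e Ω Ω * neg_one_pow_sq r

theorem semiSquare_smul (s : ℝ) (Ω : V [⋀^Fin (k + 1)]→ₗ[ℝ] ℝ) :
    semiSquare e (s • Ω) = s ^ 2 • semiSquare e Ω := by
  ext u v
  rw [LinearMap.smul_apply, LinearMap.smul_apply, smul_eq_mul, semiSquare_eq, semiSquare_eq,
    AlternatingMap.curryLeft_smul]
  simp only [LinearMap.smul_apply, map_smul, smul_eq_mul]
  ring

theorem formSq_smul (s : ℝ) (Ω : V [⋀^Fin (k + 1)]→ₗ[ℝ] ℝ) :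
    formSq e (s • Ω) = s ^ 2 * formSq e Ω := by
  simp only [formSq, map_smul, LinearMap.smul_apply, smul_eq_mul]
  ring

theorem fillSlots_zero (h : 0 + N = N) (η : V [⋀^Fin N]→ₗ[ℝ] ℝ) (w : Fin 0 → V) :
    fillSlots h η w = η := by
  ext v
  rw [fillSlots_eq_append, Fin.append_left_nil]
  · rfl
  · rfl

theorem semiSquare_det {e : Module.Basis (Fin (k + 1)) ℝ V} (he : IsLorentzFrame g e) :
    semiSquare e e.det = g := by
  ext u v
  have h := formInner_curryLeft_fillSlots he (Nat.zero_add (k + 1)) ![] ![] u v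
  rw [fillSlots_zero, prod_sgn (p := k) (q := 0) rfl] at h
  rw [semiSquare_eq, h, wedge_apply, Matrix.det_isEmpty, Finset.univ_eq_empty, Finset.sum_empty,
    he.comm v]
  field_simp
  linear_combination g u v * neg_one_pow_sq k

theorem formSq_det {e : Module.Basis (Fin (k + 1)) ℝ V} (he : IsLorentzFrame g e) :
    formSq e e.det = 1 := by
  have h := formInner_fillSlots he (Nat.zero_add (k + 1)) ![] ![]
  rw [fillSlots_zero, prod_sgn (p := k) (q := 0) rfl] at h
  rw [formSq, h, wedge_apply, Matrix.det_isEmpty]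
  field_simp
  linear_combination neg_one_pow_sq k

theorem superenergy_eq (he : IsLorentzFrame g e) (h : k + 1 + q = N)
    (Ω : V [⋀^Fin (k + 1)]→ₗ[ℝ] ℝ) :
    superenergy g e h Ω = semiSquare e Ω - (1 / 2 * formSq e Ω) • g := by
  obtain _ | r := q
  · subst h
    obtain ⟨f, rfl⟩ : ∃ f : ℝ, Ω = f • e.det := ⟨Ω e, Ω.eq_smul_basis_det e⟩
    have hf : (f • e.det) (fun i => e (Fin.cast rfl i)) = f := by
      simpa using congrArg (f * ·) e.det_self
    rw [superenergy, hf, semiSquare_smul, formSq_smul, semiSquare_det he, formSq_det he]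
    module
  · rw [superenergy, semiSquare_hodgeDual he]
    module

theorem superenergy_hodgeDual (he : IsLorentzFrame g e) (h : k + 1 + (r + 1) = N)
    (h' : r + 1 + (k + 1) = N) (Ω : V [⋀^Fin (k + 1)]→ₗ[ℝ] ℝ) :
    superenergy g e h' (hodgeDual e h Ω) = superenergy g e h Ω := by
  rw [superenergy_eq he, superenergy_eq he, semiSquare_hodgeDual he, formSq_hodgeDual he]
  module

theorem superenergy_smul (he : IsLorentzFrame g e) (h : k + 1 + q = N) (s : ℝ)
    (Ω : V [⋀^Fin (k + 1)]→ₗ[ℝ] ℝ) :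
    superenergy g e h (s • Ω) = s ^ 2 • superenergy g e h Ω := by
  rw [superenergy_eq he, superenergy_eq he, semiSquare_smul, formSq_smul]
  module

theorem superenergy_isSymm (he : IsLorentzFrame g e) (h : k + 1 + q = N)
    (Ω : V [⋀^Fin (k + 1)]→ₗ[ℝ] ℝ) : (superenergy g e h Ω).IsSymm := by
  refine ⟨fun u v => ?_⟩
  rw [superenergy_eq he]
  simp only [LinearMap.sub_apply, LinearMap.smul_apply, semiSquare_eq,
    formInner_comm (Ω.curryLeft u), he.comm u]

/-! ### Positivity of the energy density -/

/-- The sum of the squares of all components of a form in the frame `e`: its full contraction with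
itself for the Euclidean metric that has `e` as orthonormal frame. -/
def componentSq (e : Module.Basis (Fin N) ℝ V) (A : V [⋀^Fin n]→ₗ[ℝ] ℝ) : ℝ :=
  ∑ c : Fin n → Fin N, A (fun i => e (c i)) ^ 2

theorem componentSq_nonneg (A : V [⋀^Fin n]→ₗ[ℝ] ℝ) : 0 ≤ componentSq e A :=
  Finset.sum_nonneg fun _ _ => sq_nonneg _

theorem eq_zero_of_componentSq_eq_zero {A : V [⋀^Fin n]→ₗ[ℝ] ℝ} (h : componentSq e A = 0) :
    A = 0 := by
  refine e.ext_alternating fun c _ => ?_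
  exact pow_eq_zero_iff two_ne_zero |>.mp
    ((Finset.sum_eq_zero_iff_of_nonneg fun _ _ => sq_nonneg _).mp h c (Finset.mem_univ c))

theorem componentSq_succ (A : V [⋀^Fin (n + 1)]→ₗ[ℝ] ℝ) :
    componentSq e A = ∑ a, componentSq e (A.curryLeft (e a)) := by
  rw [componentSq, sum_insertNth 0]
  simp only [frame_insertNth, map_insertNth_eq, componentSq]
  simp

theorem componentSq_curryLeft_comm (A : V [⋀^Fin (n + 2)]→ₗ[ℝ] ℝ) (u v : V) :
    componentSq e ((A.curryLeft u).curryLeft v) = componentSq e ((A.curryLeft v).curryLeft u) := by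
  have swap : (A.curryLeft u).curryLeft v = -(A.curryLeft v).curryLeft u := by
    have h := AlternatingMap.curryLeft_same A (u + v)
    simpa [AlternatingMap.curryLeft_add, add_eq_zero_iff_eq_neg] using h
  simp [swap, componentSq]

theorem formInner_self_zero_form (A : V [⋀^Fin 0]→ₗ[ℝ] ℝ) :
    formInner e A A = componentSq e A := by
  simp [formInner_apply, componentSq, pow_two]

section Time

variable [NeZero N]

theorem sum_sgn_mul (F : Fin N → ℝ) : ∑ a, sgn a * F a = 2 * F 0 - ∑ a, F a := by
  rw [eq_sub_iff_add_eq, ← Finset.sum_add_distrib, Finset.sum_eq_single 0]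
  · rw [sgn_zero]
    ring
  · intro a _ ha
    rw [sgn_of_ne_zero ha]
    ring
  · simp

theorem formInner_self (A : V [⋀^Fin (n + 1)]→ₗ[ℝ] ℝ) :
    formInner e A A =
      (-1) ^ n * (2 * (n + 1) * componentSq e (A.curryLeft (e 0)) - componentSq e A) := by
  induction n with
  | zero =>
    simp only [formInner_succ, sum_sgn_mul, formInner_self_zero_form, componentSq_succ A]
    simp
  | succ n ih =>
    have trace : ∑ a, componentSq e ((A.curryLeft (e a)).curryLeft (e 0)) =
        componentSq e (A.curryLeft (e 0)) := by
      simp only [componentSq_curryLeft_comm A _ (e 0), ← componentSq_succ]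
    have time : componentSq e ((A.curryLeft (e 0)).curryLeft (e 0)) = 0 := by
      simp [componentSq]
    simp only [formInner_succ A, sum_sgn_mul, ih, ← Finset.mul_sum, Finset.sum_sub_distrib, trace,
      time, ← componentSq_succ]
    push_cast
    ring

theorem formInner_curryLeft_time (A : V [⋀^Fin (n + 1)]→ₗ[ℝ] ℝ) :
    formInner e (A.curryLeft (e 0)) (A.curryLeft (e 0)) =
      (-1) ^ n * componentSq e (A.curryLeft (e 0)) := by
  obtain _ | n := n
  · rw [formInner_self_zero_form, pow_zero, one_mul]
  · rw [formInner_self, A.curryLeft_same]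
    simp [componentSq, pow_succ]

theorem superenergy_time (he : IsLorentzFrame g e) (h : k + 1 + q = N)
    (Ω : V [⋀^Fin (k + 1)]→ₗ[ℝ] ℝ) :
    superenergy g e h Ω (e 0) (e 0) = componentSq e Ω / (2 * (k + 1).factorial) := by
  rw [superenergy_eq he, LinearMap.sub_apply, LinearMap.sub_apply, LinearMap.smul_apply,
    LinearMap.smul_apply, smul_eq_mul, he.apply_zero_zero, semiSquare_eq, formSq,
    formInner_curryLeft_time, formInner_self, Nat.factorial_succ]
  have hk : (k.factorial : ℝ) ≠ 0 := by positivity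
  push_cast
  field_simp
  linear_combination componentSq e Ω * neg_one_pow_sq k

theorem superenergy_time_nonneg (he : IsLorentzFrame g e) (h : k + 1 + q = N)
    (Ω : V [⋀^Fin (k + 1)]→ₗ[ℝ] ℝ) : 0 ≤ superenergy g e h Ω (e 0) (e 0) := by
  rw [superenergy_time he]
  exact div_nonneg (componentSq_nonneg Ω) (by positivity)

theorem eq_zero_of_superenergy_time_eq_zero (he : IsLorentzFrame g e) (h : k + 1 + q = N)
    {Ω : V [⋀^Fin (k + 1)]→ₗ[ℝ] ℝ} (hΩ : superenergy g e h Ω (e 0) (e 0) = 0) : Ω = 0 := by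
  rw [superenergy_time he, div_eq_zero_iff] at hΩ
  exact eq_zero_of_componentSq_eq_zero (hΩ.resolve_right (by positivity))

end Time

end Tensor

/-! ### The Rainich property -/

section Rainich

variable {k q : ℕ}

theorem raise_eq_of_forall (he : IsLorentzFrame g e) {T : BilinForm ℝ V} {u x : V}
    (h : ∀ v, T u v = g x v) : raise e T u = x :=
  he.eq_of_forall fun v => by rw [metric_raise he, h]

theorem exists_eq_wedge_metric (he : IsLorentzFrame g e) (A : V [⋀^Fin 1]→ₗ[ℝ] ℝ) :
    ∃ w, A = wedge fun _ => g w := by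
  obtain ⟨w, hw⟩ := he.exists_dual ((AlternatingMap.ofSubsingleton ℝ V ℝ 0).symm A)
  refine ⟨w, AlternatingMap.ext fun v => ?_⟩
  have h : A v = g w (v 0) := by
    rw [← hw, AlternatingMap.ofSubsingleton_symm_apply_apply]
    exact congrArg A (funext fun i => congrArg v (Subsingleton.elim i 0))
  simp [h, wedge_apply]

theorem formInner_curryLeft_wedge (he : IsLorentzFrame g e) (A : V [⋀^Fin (k + 1)]→ₗ[ℝ] ℝ)
    (w : Fin (k + 1) → V) (u v : V) :
    formInner e (A.curryLeft u) ((wedge fun i => g (w i)).curryLeft v) =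
      k.factorial * ∑ i, g (w i) v * A (Function.update w i u) := by
  rw [curryLeft_wedge, map_sum, Finset.mul_sum]
  refine Finset.sum_congr rfl fun i _ => ?_
  rw [map_smul, smul_eq_mul, ← Fin.insertNth_removeNth, map_insertNth_eq]
  have h : formInner e (A.curryLeft u) (wedge (i.removeNth fun i => g (w i))) =
      k.factorial * A.curryLeft u (i.removeNth w) := formInner_wedge he _ _
  rw [h]
  ring

theorem superenergy_wedge_metric (he : IsLorentzFrame g e) (h : k + 1 + q = N)
    (w : Fin (k + 1) → V) (u v : V) :
    superenergy g e h (wedge fun i => g (w i)) u v = (-1) ^ k *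
      (∑ i, g (w i) v * wedge (fun j => g (w j)) (Function.update w i u) -
        1 / 2 * wedge (fun i => g (w i)) w * g u v) := by
  rw [superenergy_eq he, LinearMap.sub_apply, LinearMap.sub_apply, LinearMap.smul_apply,
    LinearMap.smul_apply, smul_eq_mul, semiSquare_eq, formInner_curryLeft_wedge he, formSq,
    formInner_wedge he]
  field_simp

theorem superenergy_wedge_one (he : IsLorentzFrame g e) (h : 0 + 1 + q = N) (w u v : V) :
    superenergy g e h (wedge fun _ => g w) u v = g w u * g w v - 1 / 2 * g w w * g u v := by
  have apply_one : ∀ x : Fin 1 → V, wedge (fun _ => g w) x = g w (x 0) := fun x => by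
    simp [wedge_apply]
  rw [superenergy_wedge_metric he h (fun _ => w)]
  simp [apply_one, mul_comm]

/-- `T` is a symmetric tensor with nonnegative energy density in the frame `e` that satisfies the
algebraic Rainich condition `T_{ac} T^c_b = l g_{ab}` for some `l ≥ 0`, written for the associated
map of vectors. -/
structure IsRainich [NeZero N] (e : Module.Basis (Fin N) ℝ V) (T : BilinForm ℝ V) : Prop where
  isSymm : T.IsSymm
  energy_nonneg : 0 ≤ T (e 0) (e 0)
  exists_raise_raise : ∃ l : ℝ, 0 ≤ l ∧ ∀ u, raise e T (raise e T u) = l • u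

section TwoForm

/-- The linear map `k^a ↦ k^a F_a^b` of a 2-form `F`. -/
def twoFormMap (e : Module.Basis (Fin N) ℝ V) (F : V [⋀^Fin 2]→ₗ[ℝ] ℝ) : V →ₗ[ℝ] V :=
  raise e (LinearMap.mk₂ ℝ (fun u v => F.curryLeft u ![v]) (fun _ _ _ => by simp)
    (fun _ _ _ => by simp only [map_smul, AlternatingMap.smul_apply])
    (fun u => (F.curryLeft u).map_vecCons_add ![])
    (fun r u v => (F.curryLeft u).map_vecCons_smul ![] r v))

theorem metric_twoFormMap (he : IsLorentzFrame g e) (F : V [⋀^Fin 2]→ₗ[ℝ] ℝ) (u v : V) :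
    g (twoFormMap e F u) v = F ![u, v] :=
  metric_raise he _ u v

theorem metric_twoFormMap_comm (he : IsLorentzFrame g e) (F : V [⋀^Fin 2]→ₗ[ℝ] ℝ) (u v : V) :
    g (twoFormMap e F u) v = -g u (twoFormMap e F v) := by
  rw [he.comm u, metric_twoFormMap he, metric_twoFormMap he, ← F.map_swap _ zero_ne_one]
  congr 1
  ext i
  fin_cases i <;> rfl

theorem formInner_curryLeft_twoForm (he : IsLorentzFrame g e) (F G : V [⋀^Fin 2]→ₗ[ℝ] ℝ) (u v : V) :
    formInner e (F.curryLeft u) (G.curryLeft v) = g (twoFormMap e F u) (twoFormMap e G v) := by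
  have hG : G.curryLeft v = wedge fun _ => g (twoFormMap e G v) := by
    ext x
    rw [wedge_apply, Matrix.det_fin_one, Matrix.of_apply, metric_twoFormMap he]
    exact congrArg G (funext fun i => by fin_cases i <;> rfl)
  rw [hG, formInner_wedge he (F.curryLeft u) fun _ => twoFormMap e G v, Nat.factorial_one,
    Nat.cast_one, one_mul, metric_twoFormMap he, AlternatingMap.curryLeft_apply_apply,
    ← Matrix.cons_fin_one _ ![]]

variable {e : Module.Basis (Fin 4) ℝ V}

theorem fillSlots_comm (η : V [⋀^Fin 4]→ₗ[ℝ] ℝ) (w v : Fin 2 → V) :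
    fillSlots (p := 2) (q := 2) rfl η w v = fillSlots (p := 2) (q := 2) rfl η v w := by
  have even : Equiv.Perm.sign (finAddFlip (m := 2) (n := 2)) = 1 := by decide
  have h := η.map_perm (Fin.append v w) (finAddFlip (m := 2) (n := 2))
  rw [even, one_smul] at h
  rw [fillSlots_eq_append, fillSlots_eq_append]
  refine Eq.trans (congrArg η (funext fun i => ?_)) h
  fin_cases i <;> rfl

theorem formInner_hodgeDual_comm (A B : V [⋀^Fin 2]→ₗ[ℝ] ℝ) :
    formInner e (hodgeDual e (q := 2) rfl A) B = formInner e A (hodgeDual e (q := 2) rfl B) := by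
  rw [formInner_apply, formInner_apply]
  simp only [hodgeDual, AlternatingMap.smul_apply, sum_form_apply, smul_eq_mul, Finset.mul_sum,
    Finset.sum_mul]
  rw [Finset.sum_comm]
  refine Finset.sum_congr rfl fun c _ => Finset.sum_congr rfl fun d _ => ?_
  rw [fillSlots_comm]
  ring

theorem hodgeDual_hodgeDual (he : IsLorentzFrame g e) (F : V [⋀^Fin 2]→ₗ[ℝ] ℝ) :
    hodgeDual e (q := 2) rfl (hodgeDual e (q := 2) rfl F) = -F := by
  ext w
  have h := formInner_hodgeDual_comm (e := e) (hodgeDual e (q := 2) rfl F) (wedge fun i => g (w i))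
  rw [formInner_hodgeDual he (k := 1) (r := 1), prod_sgn (p := 1) (q := 2) rfl, formInner_wedge he,
    formInner_wedge he] at h
  norm_num at h
  rw [AlternatingMap.neg_apply]
  linarith

theorem twoFormMap_hodgeDual_comp (he : IsLorentzFrame g e) (A B : V [⋀^Fin 2]→ₗ[ℝ] ℝ) (u : V) :
    twoFormMap e (hodgeDual e (q := 2) rfl B) (twoFormMap e (hodgeDual e (q := 2) rfl A) u) =
      twoFormMap e A (twoFormMap e B u) + (1 / 2 * formInner e A B) • u := by
  refine he.eq_of_forall fun v => ?_
  have h := formInner_curryLeft_hodgeDual he (k := 1) (r := 1) rfl A B u v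
  rw [formInner_curryLeft_twoForm he, formInner_curryLeft_twoForm he,
    prod_sgn (p := 1) (q := 2) rfl] at h
  norm_num at h
  rw [map_add, map_smul, LinearMap.add_apply, LinearMap.smul_apply, smul_eq_mul,
    metric_twoFormMap_comm he, metric_twoFormMap_comm he A, h, he.comm (twoFormMap e B u)]
  ring

theorem twoFormMap_comp_hodgeDual (he : IsLorentzFrame g e) (F : V [⋀^Fin 2]→ₗ[ℝ] ℝ) (u : V) :
    twoFormMap e F (twoFormMap e (hodgeDual e (q := 2) rfl F) u) =
      -(1 / 4 * formInner e F (hodgeDual e (q := 2) rfl F)) • u := by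
  have h := twoFormMap_hodgeDual_comp he F (hodgeDual e (q := 2) rfl F) u
  have map_neg_form : ∀ x, twoFormMap e (-F) x = -twoFormMap e F x := fun x =>
    he.eq_of_forall fun v => by simp [metric_twoFormMap he]
  rw [hodgeDual_hodgeDual he, map_neg_form] at h
  linear_combination (norm := module) (-1 / 2 : ℝ) • h

theorem isRainich_superenergy_twoForm (he : IsLorentzFrame g e) (F : V [⋀^Fin 2]→ₗ[ℝ] ℝ) :
    IsRainich e (superenergy g e (q := 2) rfl F) := by
  set φ := twoFormMap e F
  set ψ := twoFormMap e (hodgeDual e (q := 2) rfl F)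
  set α := 1 / 2 * formInner e F F with hα
  set β := -(1 / 4 * formInner e F (hodgeDual e (q := 2) rfl F))
  have raise_eq : ∀ u, raise e (superenergy g e (q := 2) rfl F) u = φ (φ u) + (1 / 2 * α) • u :=
    fun u => raise_eq_of_forall he fun v => by
      rw [superenergy_eq he, map_add, map_smul, LinearMap.add_apply, metric_twoFormMap_comm he]
      simp only [LinearMap.sub_apply, LinearMap.smul_apply, smul_eq_mul,
        semiSquare_eq, formInner_curryLeft_twoForm he, formSq, hα, φ]
      norm_num
  have ψ_sq : ∀ u, ψ (ψ u) = φ (φ u) + α • u := twoFormMap_hodgeDual_comp he F F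
  have φ_ψ : ∀ u, φ (ψ u) = β • u := twoFormMap_comp_hodgeDual he F
  refine ⟨superenergy_isSymm he _ F, superenergy_time_nonneg he _ F,
    β ^ 2 + (1 / 2 * α) ^ 2, by positivity, fun u => ?_⟩
  have φ_four : φ (φ (φ (φ u))) = β ^ 2 • u - α • φ (φ u) := by
    have h := congrArg φ (congrArg φ (ψ_sq u))
    rw [φ_ψ, map_smul, φ_ψ, map_add, map_add, map_smul, map_smul, smul_smul, ← pow_two] at h
    rw [h, add_sub_cancel_right]
  rw [raise_eq, raise_eq]
  simp only [map_add, map_smul, φ_four]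
  module

end TwoForm

variable [NeZero N]

theorem isRainich_superenergy_oneForm (he : IsLorentzFrame g e) (h : 0 + 1 + q = N)
    (Ω : V [⋀^Fin 1]→ₗ[ℝ] ℝ) : IsRainich e (superenergy g e h Ω) := by
  refine ⟨superenergy_isSymm he h Ω, superenergy_time_nonneg he h Ω, ?_⟩
  obtain ⟨w, rfl⟩ := exists_eq_wedge_metric he Ω
  have raise_eq : ∀ u, raise e (superenergy g e h (wedge fun _ => g w)) u =
      g w u • w - (1 / 2 * g w w) • u := fun u => raise_eq_of_forall he fun v => by
    simp [superenergy_wedge_one he h]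
  refine ⟨(1 / 2 * g w w) ^ 2, sq_nonneg _, fun u => ?_⟩
  simp only [raise_eq, map_sub, map_smul, smul_eq_mul]
  module

theorem isRainich_superenergy_topForm (he : IsLorentzFrame g e) (h : k + 1 + 0 = N)
    (Ω : V [⋀^Fin (k + 1)]→ₗ[ℝ] ℝ) : IsRainich e (superenergy g e h Ω) := by
  refine ⟨superenergy_isSymm he h Ω, superenergy_time_nonneg he h Ω, ?_⟩
  have raise_eq : ∀ u, raise e (superenergy g e h Ω) u =
      (1 / 2 * Ω (fun i => e (Fin.cast h i)) ^ 2) • u := fun u => raise_eq_of_forall he fun v => by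
    simp [superenergy]
  refine ⟨(1 / 2 * Ω (fun i => e (Fin.cast h i)) ^ 2) ^ 2, sq_nonneg _, fun u => ?_⟩
  rw [raise_eq, raise_eq, smul_smul, ← pow_two]

theorem isRainich_superenergy (he : IsLorentzFrame g e) (hN : N ≤ 4) (h : k + 1 + q = N)
    (Ω : V [⋀^Fin (k + 1)]→ₗ[ℝ] ℝ) : IsRainich e (superenergy g e h Ω) := by
  obtain rfl | rfl | rfl | ⟨rfl, rfl⟩ : q = 0 ∨ k = 0 ∨ q = 1 ∨ k = 1 ∧ q = 2 := by omega
  · exact isRainich_superenergy_topForm he h Ω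
  · exact isRainich_superenergy_oneForm he h Ω
  · have h' : 0 + 1 + (k + 1) = N := by omega
    rw [← superenergy_hodgeDual he h h']
    exact isRainich_superenergy_oneForm he h' _
  · subst h
    exact isRainich_superenergy_twoForm he Ω

end Rainich

/-! ### Rainich tensors and the null cone -/

section Orthochronous

variable {τ : V} {T : BilinForm ℝ V} {l : ℝ}

theorem metric_raise_raise (he : IsLorentzFrame g e) (hT : T.IsSymm)
    (hl : ∀ u, raise e T (raise e T u) = l • u) (u v : V) :
    g (raise e T u) (raise e T v) = l * g u v := by
  rw [← metric_raise_comm he hT, hl, map_smul, LinearMap.smul_apply, smul_eq_mul]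

variable [NeZero N]

theorem IsRainich.isOrthochronous (he : IsLorentzFrame g e) (hτ : 0 < g τ τ)
    (hT : IsRainich e T) : IsOrthochronous g τ (raise e T) := by
  obtain ⟨hsymm, henergy, l, hl, hsq⟩ := hT
  have h0 : 0 < g (e 0) (e 0) := by simp [he.apply_zero_zero]
  suffices IsOrthochronous g (e 0) (raise e T) from this.congr he h0 hτ
  have time_causal : IsFutureCausal g (e 0) (raise e T (e 0)) := by
    constructor
    · rwa [metric_raise_raise he hsymm hsq, he.apply_zero_zero, mul_one]
    · rwa [← metric_raise_comm he hsymm, metric_raise he]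
  have null : IsNullConePreserving g (raise e T) := fun k hk => by
    rw [metric_raise_raise he hsymm hsq, hk, mul_zero]
  refine ⟨null, fun k hk => ?_⟩
  have future : 0 ≤ g (e 0) (raise e T k) := by
    rw [← metric_raise_comm he hsymm]
    exact time_causal.metric_nonneg he h0 hk.isFutureCausal
  obtain h | h := future.eq_or_lt
  · exact Or.inl (he.eq_zero_of_orthogonal h0 h.symm (null k hk.1).ge)
  · exact Or.inr ⟨null k hk.1, h⟩

theorem IsOrthochronous.isRainich (hN : 2 ≤ N) (he : IsLorentzFrame g e) (hτ : 0 < g τ τ)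
    (hT : T.IsSymm) (h : IsOrthochronous g τ (raise e T)) : IsRainich e T := by
  have h0 : 0 < g (e 0) (e 0) := by simp [he.apply_zero_zero]
  replace h : IsOrthochronous g (e 0) (raise e T) := h.congr he hτ h0
  obtain ⟨i, hi⟩ : ∃ i : Fin N, i ≠ 0 := ⟨⟨1, hN⟩, by simp [Fin.ext_iff]⟩
  have plus_null : IsFutureNull g (e 0) (e 0 + e i) := by
    constructor <;> simp [he _ _, sgn_zero, sgn_of_ne_zero hi, hi, hi.symm]
  have minus_null : IsFutureNull g (e 0) (e 0 - e i) := by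
    constructor <;> simp [he _ _, sgn_zero, sgn_of_ne_zero hi, hi, hi.symm]
  have apply_nonneg : ∀ {k k'}, IsFutureNull g (e 0) k → IsFutureNull g (e 0) k' → 0 ≤ T k k' :=
    fun hk hk' => metric_raise he T _ _ ▸
      (h.isFutureCausal hk).metric_nonneg he h0 hk'.isFutureCausal
  obtain ⟨l, hl⟩ : ∃ l : ℝ, g.compl₁₂ (raise e T) (raise e T) = l • g :=
    ⟨_, he.eq_smul_of_null ⟨fun u v => he.comm _ _⟩ h.1⟩
  have metric_map : ∀ u v, g (raise e T u) (raise e T v) = l * g u v := fun u v =>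
    LinearMap.congr_fun₂ hl u v
  refine ⟨hT, ?_, l, ?_, fun u => he.eq_of_forall fun v => ?_⟩
  · have sum_nonneg := apply_nonneg plus_null plus_null
    have cross_nonneg := apply_nonneg plus_null minus_null
    have diff_nonneg := apply_nonneg minus_null minus_null
    simp only [map_add, map_sub, LinearMap.add_apply, LinearMap.sub_apply, hT.eq (e i) (e 0)]
      at sum_nonneg cross_nonneg diff_nonneg
    linarith
  · have images_nonneg := (h.isFutureCausal plus_null).metric_nonneg he h0
      (h.isFutureCausal minus_null)
    have metric_plus_minus : g (e 0 + e i) (e 0 - e i) = 2 := by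
      norm_num [he _ _, sgn_zero, sgn_of_ne_zero hi, hi, hi.symm]
    rw [metric_map, metric_plus_minus] at images_nonneg
    linarith
  · rw [metric_raise_comm he hT, metric_map, map_smul, LinearMap.smul_apply, smul_eq_mul]

theorem isRainich_iff (hN : 2 ≤ N) (he : IsLorentzFrame g e) (hτ : 0 < g τ τ) :
    IsRainich e T ↔ T.IsSymm ∧ IsOrthochronous g τ (raise e T) :=
  ⟨fun h => ⟨h.isSymm, h.isOrthochronous he hτ⟩, fun h => h.2.isRainich hN he hτ h.1⟩

end Orthochronous

/-! ### Rainich tensors are superenergy tensors of simple forms -/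

section Simple

variable {n k q : ℕ} {T : BilinForm ℝ V} {μ : ℝ}

theorem pi_surjective_of_linearIndependent {ω : Fin n → Module.Dual ℝ V}
    (hω : LinearIndependent ℝ ω) : Function.Surjective (LinearMap.pi ω) := by
  rw [← LinearMap.dualMap_injective_iff, injective_iff_map_eq_zero]
  refine fun φ hφ => LinearMap.pi_ext' fun i => LinearMap.ext_ring ?_
  refine Fintype.linearIndependent_iff.mp hω (fun i => φ (Pi.single i 1)) ?_ i
  ext v
  rw [← hφ, LinearMap.dualMap_apply, LinearMap.pi_apply_eq_sum_univ φ, LinearMap.sum_apply]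
  refine Finset.sum_congr rfl fun i _ => ?_
  rw [LinearMap.smul_apply, smul_eq_mul, smul_eq_mul, mul_comm, LinearMap.pi_apply]
  congr 2
  ext j
  simp [Pi.single_apply, eq_comm]

theorem IsSimpleForm.ne_zero {Ω : V [⋀^Fin n]→ₗ[ℝ] ℝ} (h : IsSimpleForm Ω) : Ω ≠ 0 := by
  obtain ⟨ω, hω, rfl⟩ := h
  choose v hv using fun j => pi_surjective_of_linearIndependent hω (Pi.single j (1 : ℝ))
  have dual : (Matrix.of fun i j => ω j (v i)) = 1 := by
    ext i j
    simpa [Matrix.one_apply, Pi.single_apply, eq_comm] using congrFun (hv i) j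
  intro h0
  simpa [wedge_apply, dual] using DFunLike.congr_fun h0 v

theorem wedge_smul (c : Fin n → ℝ) (ω : Fin n → Module.Dual ℝ V) :
    wedge (fun i => c i • ω i) = (∏ i, c i) • wedge ω := by
  ext v
  exact Matrix.det_mul_row c (Matrix.of fun i j => ω j (v i))

theorem IsSimpleForm.smul {Ω : V [⋀^Fin (k + 1)]→ₗ[ℝ] ℝ} (h : IsSimpleForm Ω) {s : ℝ}
    (hs : s ≠ 0) : IsSimpleForm (s • Ω) := by
  obtain ⟨ω, hω, rfl⟩ := h
  let c : Fin (k + 1) → ℝˣ := Pi.mulSingle 0 (Units.mk0 s hs)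
  have prod_c : ∏ i, (c i : ℝ) = s := by
    rw [← Units.coe_prod, Fintype.prod_pi_mulSingle']
    simp
  refine ⟨_, hω.units_smul c, ?_⟩
  rw [← prod_c]
  exact (wedge_smul (fun i => (c i : ℝ)) ω).symm

theorem smul_mem_SS (he : IsLorentzFrame g e) (hT : T ∈ SS g e) {c : ℝ} (hc : 0 < c) :
    c • T ∈ SS g e := by
  obtain ⟨k, q, h, Ω, hΩ, rfl⟩ := hT
  refine ⟨k, q, h, √c • Ω, hΩ.smul (Real.sqrt_pos.mpr hc).ne', ?_⟩
  rw [superenergy_smul he, Real.sq_sqrt hc.le]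

theorem IsLorentzFrame.isSimpleForm_wedge_metric (he : IsLorentzFrame g e) {w : Fin n → V}
    (hw : LinearIndependent ℝ w) : IsSimpleForm (wedge fun i => g (w i)) := by
  refine ⟨_, hw.map' g (LinearMap.ker_eq_bot'.mpr fun x hx => ?_), rfl⟩
  exact he.eq_of_forall fun v => by rw [hx, map_zero]

theorem wedge_update_congr {ω : Fin n → Module.Dual ℝ V} {x y : V} (h : ∀ i, ω i x = ω i y)
    (w : Fin n → V) (i : Fin n) :
    wedge ω (Function.update w i x) = wedge ω (Function.update w i y) := by
  rw [wedge_apply, wedge_apply]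
  congr
  ext a b
  by_cases ha : a = i
  · subst ha
    simp [h]
  · simp [ha]

theorem sum_mul_apply_update_of_mem_span (A : V [⋀^Fin n]→ₗ[ℝ] ℝ) (α : Module.Dual ℝ V)
    {w : Fin n → V} {x : V} (hx : x ∈ Submodule.span ℝ (Set.range w)) :
    ∑ i, α (w i) * A (Function.update w i x) = α x * A w := by
  let L : V →ₗ[ℝ] ℝ := ∑ i, α (w i) • A.toMultilinearMap.toLinearMap w i
  have hL : ∀ y, L y = ∑ i, α (w i) * A (Function.update w i y) := fun y => by
    simp [L]
  rw [← hL]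
  refine LinearMap.eqOn_span (g := A w • α) (fun y hy => ?_) hx |>.trans (mul_comm _ _)
  obtain ⟨j, rfl⟩ := hy
  rw [hL, Finset.sum_eq_single j, Function.update_eq_self, LinearMap.smul_apply, smul_eq_mul,
    mul_comm]
  · intro i _ hij
    rw [A.map_update_self _ hij, mul_zero]
  · simp

theorem superenergy_wedge_eigenspace (he : IsLorentzFrame g e) (h : k + 1 + q = N)
    (hT : T.IsSymm) (hμ : μ ≠ 0) {w : Fin (k + 1) → V} (hw : ∀ i, raise e T (w i) = μ • w i)
    (hspan : ∀ u, raise e T u + μ • u ∈ Submodule.span ℝ (Set.range w)) :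
    ∃ c : ℝ, superenergy g e h (wedge fun i => g (w i)) = c • T := by
  refine ⟨(-1) ^ k * wedge (fun i => g (w i)) w * (2 * μ)⁻¹, ?_⟩
  ext u v
  -- The wedge product depends only on the component of `u` in the eigenspace `W` of `μ`, and
  -- `(T + μ) / (2 * μ)` is the orthogonal projection onto `W` when `T ∘ T = μ² • id`.
  have project : ∀ i, g (w i) u = g (w i) ((2 * μ)⁻¹ • (raise e T u + μ • u)) := fun i => by
    rw [map_smul, map_add, map_smul, ← metric_raise_comm he hT, hw, map_smul,
      LinearMap.smul_apply, smul_eq_mul, smul_eq_mul]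
    field_simp
    ring
  simp only [superenergy_wedge_metric he, wedge_update_congr project, he.comm (w _) v]
  rw [sum_mul_apply_update_of_mem_span _ (g v) (Submodule.smul_mem _ _ (hspan u)), map_smul,
    map_add, map_smul, he.comm v, metric_raise he, he.comm v]
  simp only [LinearMap.smul_apply, smul_eq_mul]
  field_simp
  ring

theorem exists_basis_of_ne_bot [FiniteDimensional ℝ V] {W : Submodule ℝ V} (hW : W ≠ ⊥) :
    ∃ (k : ℕ) (w : Fin (k + 1) → V), LinearIndependent ℝ w ∧
      Submodule.span ℝ (Set.range w) = W := by
  obtain ⟨k, hk⟩ := Nat.exists_eq_succ_of_ne_zero (mt Submodule.finrank_eq_zero.mp hW)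
  let b := Module.finBasisOfFinrankEq ℝ W hk
  refine ⟨k, W.subtype ∘ b, b.linearIndependent.map' _ W.ker_subtype, ?_⟩
  rw [Set.range_comp, Submodule.span_image, b.span_eq, Submodule.map_top, W.range_subtype]

theorem exists_add_eq_of_linearIndependent (e : Module.Basis (Fin N) ℝ V) {w : Fin n → V}
    (hw : LinearIndependent ℝ w) : ∃ q, n + q = N := by
  have := Module.Basis.finiteDimensional_of_finite e
  have h := hw.fintype_card_le_finrank
  rw [Fintype.card_fin, Module.finrank_eq_card_basis e, Fintype.card_fin] at h
  exact Nat.exists_eq_add_of_le h |>.imp fun _ => Eq.symm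

variable [NeZero N]

theorem superenergy_time_pos_of_isSimpleForm (he : IsLorentzFrame g e) (h : k + 1 + q = N)
    {Ω : V [⋀^Fin (k + 1)]→ₗ[ℝ] ℝ} (hΩ : IsSimpleForm Ω) :
    0 < superenergy g e h Ω (e 0) (e 0) :=
  (superenergy_time_nonneg he h Ω).lt_of_ne' fun h0 =>
    hΩ.ne_zero (eq_zero_of_superenergy_time_eq_zero he h h0)

theorem mem_SS_of_superenergy_eq_smul (he : IsLorentzFrame g e) (h : k + 1 + q = N)
    {Ω : V [⋀^Fin (k + 1)]→ₗ[ℝ] ℝ} (hΩ : IsSimpleForm Ω) {c : ℝ} (hT : 0 ≤ T (e 0) (e 0))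
    (hc : superenergy g e h Ω = c • T) : T ∈ SS g e := by
  have c_pos : 0 < c := by
    have energy_pos := superenergy_time_pos_of_isSimpleForm he h hΩ
    rw [hc, LinearMap.smul_apply, LinearMap.smul_apply, smul_eq_mul] at energy_pos
    exact pos_of_mul_pos_left energy_pos hT
  rw [← inv_smul_smul₀ c_pos.ne' T, ← hc]
  exact smul_mem_SS he ⟨k, q, h, Ω, hΩ, rfl⟩ (inv_pos.mpr c_pos)

theorem mem_SS_of_raise_raise_eq_sq (he : IsLorentzFrame g e) (hT : T.IsSymm)
    (henergy : 0 ≤ T (e 0) (e 0)) (hμ : 0 < μ)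
    (hsq : ∀ u, raise e T (raise e T u) = (μ * μ) • u) : T ∈ SS g e := by
  have := Module.Basis.finiteDimensional_of_finite e
  let W := LinearMap.ker (raise e T - μ • LinearMap.id)
  have mem_W : ∀ {u}, u ∈ W ↔ raise e T u = μ • u := fun {u} => by simp [W, sub_eq_zero]
  have proj_mem : ∀ u, raise e T u + μ • u ∈ W := fun u => mem_W.mpr <| by
    rw [map_add, map_smul, hsq]
    module
  have W_ne_bot : W ≠ ⊥ := fun hW => by
    have h := proj_mem (e 0)
    rw [hW, Submodule.mem_bot, add_eq_zero_iff_eq_neg] at h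
    rw [← metric_raise he, h, map_neg, map_smul, LinearMap.neg_apply, LinearMap.smul_apply,
      he.apply_zero_zero, smul_eq_mul] at henergy
    linarith
  obtain ⟨k, w, hw, hspan⟩ := exists_basis_of_ne_bot W_ne_bot
  obtain ⟨q, h⟩ := exists_add_eq_of_linearIndependent e hw
  have w_mem : ∀ i, raise e T (w i) = μ • w i := fun i =>
    mem_W.mp (hspan ▸ Submodule.subset_span ⟨i, rfl⟩)
  obtain ⟨c, hc⟩ := superenergy_wedge_eigenspace he h hT hμ.ne' w_mem (hspan ▸ proj_mem)
  exact mem_SS_of_superenergy_eq_smul he h (he.isSimpleForm_wedge_metric hw) henergy hc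

theorem mem_SS_of_raise_raise_eq_zero (he : IsLorentzFrame g e) (hT : T.IsSymm)
    (henergy : 0 ≤ T (e 0) (e 0)) (hsq : ∀ u, raise e T (raise e T u) = 0) (hT0 : T ≠ 0) :
    T ∈ SS g e := by
  have h0 : 0 < g (e 0) (e 0) := by simp [he.apply_zero_zero]
  have image_null : ∀ u v, g (raise e T u) (raise e T v) = 0 := fun u v => by
    rw [← metric_raise_comm he hT, hsq, map_zero, LinearMap.zero_apply]
  set x := raise e T (e 0)
  set t := T (e 0) (e 0)
  have time_x : g (e 0) x = t := by rw [he.comm, metric_raise he]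
  have time_raise : ∀ u, g (e 0) (raise e T u) = g x u := fun u =>
    (metric_raise_comm he hT _ _).symm
  have image_eq : ∀ u, t • raise e T u = g x u • x := fun u => by
    refine sub_eq_zero.mp (he.eq_zero_of_orthogonal h0 ?_ ?_)
    · rw [map_sub, map_smul, map_smul, time_raise, time_x, smul_eq_mul, smul_eq_mul]
      ring
    · simp [image_null, x]
  have x_ne_zero : x ≠ 0 := fun hx => hT0 <| LinearMap.ext₂ fun u v => by
    have hu : raise e T u = 0 := he.eq_zero_of_orthogonal h0 (by simp [time_raise, hx])
      (image_null u u).ge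
    rw [← metric_raise he, hu]
    simp
  have x_indep : LinearIndependent ℝ fun _ : Fin 1 => x :=
    linearIndependent_unique_iff.mpr x_ne_zero
  obtain ⟨q, h⟩ : ∃ q, 0 + 1 + q = N := exists_add_eq_of_linearIndependent e x_indep
  refine mem_SS_of_superenergy_eq_smul he h (c := t) (he.isSimpleForm_wedge_metric x_indep)
    henergy ?_
  ext u v
  have huv := congrArg (g · v) (image_eq u)
  simp only [map_smul, LinearMap.smul_apply, metric_raise he, smul_eq_mul] at huv
  rw [superenergy_wedge_one he, image_null, LinearMap.smul_apply, LinearMap.smul_apply,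
    smul_eq_mul, huv]
  ring

theorem IsRainich.mem_SS (he : IsLorentzFrame g e) (hT : IsRainich e T) (hT0 : T ≠ 0) :
    T ∈ SS g e := by
  obtain ⟨hsymm, henergy, l, hl, hsq⟩ := hT
  obtain rfl | hl := hl.eq_or_lt
  · exact mem_SS_of_raise_raise_eq_zero he hsymm henergy (by simpa using hsq) hT0
  · exact mem_SS_of_raise_raise_eq_sq he hsymm henergy (Real.sqrt_pos.mpr hl)
      (by rwa [Real.mul_self_sqrt hl.le])

theorem SE₂_eq_setOf_isRainich (he : IsLorentzFrame g e) (hN : N ≤ 4) :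
    SE₂ g e = {T | IsRainich e T} := by
  ext T
  constructor
  · rintro ⟨k, q, h, Ω, rfl⟩
    exact isRainich_superenergy he hN h Ω
  · intro hT
    by_cases hT0 : T = 0
    · obtain ⟨n, rfl⟩ := Nat.exists_eq_succ_of_ne_zero (NeZero.ne N)
      refine ⟨n, 0, rfl, 0, ?_⟩
      rw [hT0, superenergy]
      simp
    · obtain ⟨k, q, h, Ω, -, hΩ⟩ := IsRainich.mem_SS he hT hT0
      exact ⟨k, q, h, Ω, hΩ⟩

theorem SE₂_diff_zero (he : IsLorentzFrame g e) (hN : N ≤ 4) : SE₂ g e \ {0} = SS g e := by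
  ext T
  constructor
  · rintro ⟨hT, hT0⟩
    rw [SE₂_eq_setOf_isRainich he hN] at hT
    exact IsRainich.mem_SS he hT hT0
  · rintro ⟨k, q, h, Ω, hΩ, rfl⟩
    refine ⟨⟨k, q, h, Ω, rfl⟩, fun h0 => ?_⟩
    have energy_pos := superenergy_time_pos_of_isSimpleForm he h hΩ
    rw [Set.mem_singleton_iff.mp h0] at energy_pos
    simp at energy_pos

end Simple

section Involutions

variable {τ : V} {T : BilinForm ℝ V} {f L : V →ₗ[ℝ] V} {c l : ℝ}

theorem IsOrthochronous.smul (h : IsOrthochronous g τ f) (hc : 0 < c) :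
    IsOrthochronous g τ (c • f) := by
  refine ⟨fun k hk => by simp [h.1 k hk], fun k hk => (h.2 k hk).imp (fun hf => ?_) fun hf => ?_⟩
  · rw [LinearMap.smul_apply, hf, smul_zero]
  · rw [LinearMap.smul_apply]
    exact ⟨by simp [hf.1], by simpa using mul_pos hc hf.2⟩

theorem isLorentzTransformation_inv_sqrt_smul_raise (he : IsLorentzFrame g e) (hT : T.IsSymm)
    (hl : 0 < l) (hsq : ∀ u, raise e T (raise e T u) = l • u) :
    IsLorentzTransformation g ((√l)⁻¹ • raise e T) := fun u v => by
  simp only [LinearMap.smul_apply, map_smul, smul_eq_mul, metric_raise_raise he hT hsq]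
  field_simp
  rw [Real.sq_sqrt hl.le]

theorem isInvolutory_inv_sqrt_smul_raise (hl : 0 < l)
    (hsq : ∀ u, raise e T (raise e T u) = l • u) : IsInvolutory ((√l)⁻¹ • raise e T) := by
  ext u
  rw [LinearMap.comp_apply, LinearMap.smul_apply, LinearMap.smul_apply, map_smul, hsq, smul_smul,
    smul_smul, ← mul_inv, Real.mul_self_sqrt hl.le, inv_mul_cancel₀ hl.ne', one_smul,
    LinearMap.id_apply]

theorem isSingular_of_comp_self_eq_zero [Nontrivial V] [FiniteDimensional ℝ V]
    (h : f ∘ₗ f = 0) : IsSingular f := by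
  have det_sq := LinearMap.det_comp f f
  rw [h, LinearMap.det_zero, zero_pow Module.finrank_pos.ne'] at det_sq
  exact mul_self_eq_zero.mp det_sq.symm

theorem isSymm_of_raise_eq_smul_involution (he : IsLorentzFrame g e)
    (hL : IsLorentzTransformation g L) (hinv : IsInvolutory L) (h : raise e T = c • L) :
    T.IsSymm := by
  refine ⟨fun u v => ?_⟩
  have L_L : L (L v) = v := LinearMap.congr_fun hinv v
  rw [← metric_raise he, ← metric_raise he T v, h]
  simp only [LinearMap.smul_apply, map_smul]
  rw [← hL (L v), L_L, he.comm]

theorem orthochronous_eq_union (hN : 2 ≤ N) (he : IsLorentzFrame g e) (hτ : 0 < g τ τ) :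
    {T : BilinForm ℝ V | T.IsSymm ∧ IsOrthochronous g τ (raise e T)} =
      {T | ∃ c : ℝ, 0 < c ∧ ∃ L : V →ₗ[ℝ] V, IsLorentzTransformation g L ∧
          IsInvolutory L ∧ IsOrthochronous g τ L ∧ raise e T = c • L} ∪
      {T | T.IsSymm ∧ IsSingular (raise e T) ∧ IsOrthochronous g τ (raise e T) ∧
          IsNullConeBiPreserving g e T} := by
  have : NeZero N := ⟨by omega⟩
  have := Module.Basis.finiteDimensional_of_finite e
  have : Nontrivial V := ⟨e 0, 0, e.ne_zero 0⟩
  ext T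
  constructor
  · rintro ⟨hT, h⟩
    obtain ⟨-, -, l, hl, hsq⟩ := h.isRainich hN he hτ hT
    obtain rfl | hl := hl.eq_or_lt
    · have comp_eq_zero : raise e T ∘ₗ raise e T = 0 := LinearMap.ext fun u => by simp [hsq]
      have flip_eq : T.flip = T := LinearMap.ext₂ fun u v => hT.eq v u
      exact Or.inr ⟨hT, isSingular_of_comp_self_eq_zero comp_eq_zero, h, h.1, flip_eq.symm ▸ h.1⟩
    · have hs : 0 < √l := Real.sqrt_pos.mpr hl
      exact Or.inl ⟨√l, hs, (√l)⁻¹ • raise e T,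
        isLorentzTransformation_inv_sqrt_smul_raise he hT hl hsq,
        isInvolutory_inv_sqrt_smul_raise hl hsq, h.smul (inv_pos.mpr hs),
        (smul_inv_smul₀ hs.ne' _).symm⟩
  · rintro (⟨c, hc, L, hL, hinv, hL', h⟩ | ⟨hT, -, h, -⟩)
    · exact ⟨isSymm_of_raise_eq_smul_involution he hL hinv h, h ▸ hL'.smul hc⟩
    · exact ⟨hT, h⟩

end Involutions

section Negation

variable {τ : V} {T : BilinForm ℝ V} {f L : V →ₗ[ℝ] V}

theorem raise_neg : raise e (-T) = -raise e T := by
  ext u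
  simp [raise]

theorem isNullConePreserving_neg : IsNullConePreserving g (-f) ↔ IsNullConePreserving g f := by
  simp [IsNullConePreserving]

theorem isOrthochronous_neg : IsOrthochronous g τ (-f) ↔ IsTimeReversal g τ f := by
  simp [IsOrthochronous, IsTimeReversal, isNullConePreserving_neg]

theorem isTimeReversal_neg : IsTimeReversal g τ (-f) ↔ IsOrthochronous g τ f := by
  rw [← isOrthochronous_neg, neg_neg]

theorem isNullConeBiPreserving_neg :
    IsNullConeBiPreserving g e (-T) ↔ IsNullConeBiPreserving g e T := by
  have flip_neg : (-T).flip = -T.flip := rfl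
  rw [IsNullConeBiPreserving, IsNullConeBiPreserving, flip_neg, raise_neg, raise_neg,
    isNullConePreserving_neg, isNullConePreserving_neg]

theorem isSingular_neg : IsSingular (-f) ↔ IsSingular f := by
  rw [IsSingular, IsSingular, ← neg_one_smul ℝ f, LinearMap.det_smul]
  simp

theorem isSymm_neg : (-T).IsSymm ↔ T.IsSymm := by
  simp [LinearMap.BilinForm.isSymm_def]

theorem isLorentzTransformation_neg :
    IsLorentzTransformation g (-L) ↔ IsLorentzTransformation g L := by
  simp [IsLorentzTransformation]

theorem isInvolutory_neg : IsInvolutory (-L) ↔ IsInvolutory L := by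
  simp [IsInvolutory, LinearMap.neg_comp, LinearMap.comp_neg]

theorem exists_orthochronous_involution_neg :
    (∃ c : ℝ, 0 < c ∧ ∃ L : V →ₗ[ℝ] V, IsLorentzTransformation g L ∧ IsInvolutory L ∧
      IsOrthochronous g τ L ∧ raise e (-T) = c • L) ↔
    ∃ c : ℝ, 0 < c ∧ ∃ L : V →ₗ[ℝ] V, IsLorentzTransformation g L ∧ IsInvolutory L ∧
      IsTimeReversal g τ L ∧ raise e T = c • L := by
  refine exists_congr fun c => and_congr_right fun _ =>
    (Equiv.neg (V →ₗ[ℝ] V)).exists_congr fun L => ?_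
  rw [Equiv.neg_apply, isLorentzTransformation_neg, isInvolutory_neg, isTimeReversal_neg,
    raise_neg, smul_neg, neg_eq_iff_eq_neg]

end Negation

end

end Superenergy

theorem mainTheorem11 {V : Type*} [AddCommGroup V] [Module ℝ V] {N : ℕ} (hN : 2 ≤ N) (hN' : N ≤ 4)
    (g : LinearMap.BilinForm ℝ V) (e : Module.Basis (Fin N) ℝ V)
    (he : Superenergy.IsLorentzFrame g e) (τ : V) (hτ : 0 < g τ τ) :
    Superenergy.SE₂ g e \ {0} = Superenergy.SS g e ∧
    Superenergy.SE₂ g e =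
      {T | T.IsSymm ∧ Superenergy.IsOrthochronous g τ (Superenergy.raise e T)} ∧
    Superenergy.SE₂ g e =
      {T | ∃ c : ℝ, 0 < c ∧ ∃ L : V →ₗ[ℝ] V, Superenergy.IsLorentzTransformation g L ∧
          Superenergy.IsInvolutory L ∧ Superenergy.IsOrthochronous g τ L ∧
          Superenergy.raise e T = c • L} ∪
      {T | T.IsSymm ∧ Superenergy.IsSingular (Superenergy.raise e T) ∧
          Superenergy.IsOrthochronous g τ (Superenergy.raise e T) ∧
          Superenergy.IsNullConeBiPreserving g e T} ∧
    {T | -T ∈ Superenergy.SE₂ g e} =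
      {T | T.IsSymm ∧ Superenergy.IsTimeReversal g τ (Superenergy.raise e T)} ∧
    {T | -T ∈ Superenergy.SE₂ g e} =
      {T | ∃ c : ℝ, 0 < c ∧ ∃ L : V →ₗ[ℝ] V, Superenergy.IsLorentzTransformation g L ∧
          Superenergy.IsInvolutory L ∧ Superenergy.IsTimeReversal g τ L ∧
          Superenergy.raise e T = c • L} ∪
      {T | T.IsSymm ∧ Superenergy.IsSingular (Superenergy.raise e T) ∧
          Superenergy.IsTimeReversal g τ (Superenergy.raise e T) ∧
          Superenergy.IsNullConeBiPreserving g e T} := by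
  have : NeZero N := ⟨by omega⟩
  have h2 : Superenergy.SE₂ g e =
      {T | T.IsSymm ∧ Superenergy.IsOrthochronous g τ (Superenergy.raise e T)} :=
    (Superenergy.SE₂_eq_setOf_isRainich he hN').trans <|
      Set.ext fun _ => Superenergy.isRainich_iff hN he hτ
  have h3 := h2.trans (Superenergy.orthochronous_eq_union hN he hτ)
  refine ⟨Superenergy.SE₂_diff_zero he hN', h2, h3, ?_, ?_⟩
  · ext T
    rw [Set.mem_ofPred_eq, h2, Set.mem_ofPred_eq, Set.mem_ofPred_eq, Superenergy.isSymm_neg,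
      Superenergy.raise_neg, Superenergy.isOrthochronous_neg]
  · ext T
    rw [Set.mem_ofPred_eq, h3]
    refine or_congr Superenergy.exists_orthochronous_involution_neg ?_
    rw [Set.mem_ofPred_eq, Set.mem_ofPred_eq, Superenergy.isSymm_neg,
      Superenergy.isNullConeBiPreserving_neg, Superenergy.raise_neg, Superenergy.isSingular_neg,
      Superenergy.isOrthochronous_neg]
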